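/- **Setting.** For a bounded open set $\Omega\subset\mathbb R^d$, let $H^1(\Omega)$ be the space of all $u\in L^2(\Omega)$ whose weak gradient is in $L^2(\Omega)^d$, normed by $\|u\|^2=\|u\|_{L^2}^2+\|\nabla u\|_{L^2}^2$, and let $\widetilde H^1(\Omega)$ be the closure in $H^1(\Omega)$ of $H^1(\Omega)\cap C^0(\overline\Omega)$. For a unit vector $\theta$ and $x\in\Omega$, let $\Phi_\theta(x)=x+\delta_\theta(x)\theta$ with $\delta_\theta(x)=\sup\{s\ge 0: x+t\theta\in\Omega\ \forall t\in[0,s)\}$, and let $\mu_\theta$ be the measure on $\partial\Omega$ given by $\mu_\theta(A)=|\{x\in\Omega:\Phi_\theta(x)\in A\}|$. Let $P_\theta(x)=x-(x\cdot\theta)\theta$ and $\omega_\theta(y)=\{s\in\mathbb R:s\theta+y\in\Omega\}$. A function $g:\partial\Omega\to\mathbb R$ is a *directional trace* of $u\in H^1(\Omega)$ in the direction $\theta$ if, for some representative of $u$ and for all $y\in P_\theta(\Omega)$ outside a set of $(d-1)$-dimensional Lebesgue measure zero, the function $s\mapsto u(s\theta+y)$ belongs to $H^1(\omega_\theta(y))$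 and, for each maximal interval $(\alpha,\beta)$ of $\omega_\theta(y)$, it agrees a.e. on $(\alpha,\beta)$ with a function that is continuous on $(\alpha,\beta]$ and has the value $g(\beta\theta+y)$ at $\beta$. The space $H^1_{\rm tr}(\Omega)$ consists of all $u\in H^1(\Omega)$ for which there is a function $g:\partial\Omega\to\mathbb R$ such that $g\in L^2(\partial\Omega,\mu_\theta)$ for all unit vectors $\theta$, with norms bounded independently of $\theta$, and such that, for every unit vector $\theta$, $g$ is $\mu_\theta$-a.e. equal to a directional trace of $u$ in the direction $\theta$. **Domain.** Let $\mathcal C\subset[0,1]$ be the middle-third Cantor set, $K_a=\{(x_1,x_2): 0<x_2<1,\ |x_1-a|<x_2\}$, $\Omega_{\mathcal C}=\bigcup_{a\in\mathcal C}K_a$, $\psi(x_1,x_2)=(x_1,-x_2)$ and $\Omega=\Omega_{\mathcal C}\cup\psi(\Omega_{\mathcal C})\subset\mathbb R^2$. For $n\in\mathbb N$ let $y_n=3^{-n}/2$ and $\mathcal D_n=\{x\in\mathbb R:(x,y_n)\in\Omega_{\mathcal C}\}$. **Statement.** The set $\Omega$ is open and bounded. The function $\widehat u$ that is equal to $1$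 on $\Omega_{\mathcal C}$ and to $-1$ on $\psi(\Omega_{\mathcal C})$ belongs to $H^1_{\rm tr}(\Omega)\setminus\widetilde H^1(\Omega)$; in particular, this set is not empty. Moreover, every $v\in H^1(\Omega)$ has a trace on each set $\mathcal D_n\times\{y_n\}$ (for a.e. $x\in\mathcal D_n$, the value at $y_n$ of the representative of $y\mapsto v(x,y)$ that is continuous near $y_n$), this trace is integrable, and the averages $\nu_n(v)=\frac1{|\mathcal D_n|}\int_{\mathcal D_n}v(x,y_n)\,dx$ define continuous linear forms $\nu_n$ on $H^1(\Omega)$ that converge, in the norm of the dual space $H^1(\Omega)'$, to some $\overline\nu\in H^1(\Omega)'$. For every $v\in H^1(\Omega)$ one has $v\circ\psi\in H^1(\Omega)$, and $\overline\nu_\psi(v)=\overline\nu(v\circ\psi)$ defines a continuous linear form $\overline\nu_\psi$ on $H^1(\Omega)$. The continuous linear form $\overline\nu-\overline\nu_\psi$ vanishes on $\widetilde H^1(\Omega)$, and $(\overline\nu-\overline\nu_\psi)(\widehat u)=2$. -/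

import Mathlib

open Set Filter Topology MeasureTheory
open scoped ContDiff RealInnerProductSpace

noncomputable section

/-! ## Weak gradients and the Sobolev space `H¹(Ω)` -/

/-- Test functions: the elements of `C_c^∞(Ω)`. -/
def IsTestFunction {E : Type*} [NormedAddCommGroup E] [InnerProductSpace ℝ E]
    (Ω : Set E) (φ : E → ℝ) : Prop :=
  ContDiff ℝ ∞ φ ∧ HasCompactSupport φ ∧ tsupport φ ⊆ Ω

/-- `g` is the gradient of `u` on `Ω` in the sense of distributions: for every vector `v`,
`∫_Ω u ∂_v φ = - ∫_Ω ⟨g, v⟩ φ` for all test functions `φ`. -/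
def IsWeakGradient {E : Type*} [NormedAddCommGroup E] [InnerProductSpace ℝ E] [MeasureSpace E]
    (Ω : Set E) (u : E → ℝ) (g : E → E) : Prop :=
  ∀ φ : E → ℝ, IsTestFunction Ω φ → ∀ v : E,
    ∫ x in Ω, u x * fderiv ℝ φ x v = - ∫ x in Ω, ⟪g x, v⟫ * φ x

/-- The function `u` belongs to `H¹(Ω)`: it is in `L²(Ω)` and has a weak gradient in `L²(Ω)`. -/
def MemH1 {E : Type*} [NormedAddCommGroup E] [InnerProductSpace ℝ E] [MeasureSpace E]
    (Ω : Set E) (u : E → ℝ) : Prop :=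
  MemLp u 2 (volume.restrict Ω) ∧
    ∃ g : E → E, MemLp g 2 (volume.restrict Ω) ∧ IsWeakGradient Ω u g

section Helpers

variable {E : Type*} [NormedAddCommGroup E] [InnerProductSpace ℝ E] [MeasureSpace E]

theorem IsWeakGradient.congr {Ω : Set E} {u u' : E → ℝ} {g g' : E → E}
    (h : IsWeakGradient Ω u g) (hu : u' =ᵐ[volume.restrict Ω] u)
    (hg : g' =ᵐ[volume.restrict Ω] g) : IsWeakGradient Ω u' g' := by
  intro φ hφ v
  have h1 : ∫ x in Ω, u' x * fderiv ℝ φ x v = ∫ x in Ω, u x * fderiv ℝ φ x v :=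
    integral_congr_ae (hu.mono fun x hx => by simp only [hx])
  have h2 : ∫ x in Ω, ⟪g' x, v⟫ * φ x = ∫ x in Ω, ⟪g x, v⟫ * φ x :=
    integral_congr_ae (hg.mono fun x hx => by simp only [hx])
  rw [h1, h2]
  exact h φ hφ v

theorem IsWeakGradient.zero (Ω : Set E) :
    IsWeakGradient Ω (fun _ => (0 : ℝ)) (fun _ => (0 : E)) := by
  intro φ _ v
  simp

theorem IsWeakGradient.const_smul {Ω : Set E} {u : E → ℝ} {g : E → E}
    (h : IsWeakGradient Ω u g) (c : ℝ) :
    IsWeakGradient Ω (fun x => c * u x) (fun x => c • g x) := by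
  intro φ hφ v
  simp only [real_inner_smul_left, mul_assoc, integral_const_mul]
  rw [h φ hφ v, mul_neg]

theorem IsWeakGradient.add [BorelSpace E] [IsFiniteMeasureOnCompacts (volume : Measure E)]
    {Ω : Set E} {u₁ u₂ : E → ℝ} {g₁ g₂ : E → E}
    (hu₁ : MemLp u₁ 2 (volume.restrict Ω)) (hu₂ : MemLp u₂ 2 (volume.restrict Ω))
    (hg₁ : MemLp g₁ 2 (volume.restrict Ω)) (hg₂ : MemLp g₂ 2 (volume.restrict Ω))
    (h₁ : IsWeakGradient Ω u₁ g₁) (h₂ : IsWeakGradient Ω u₂ g₂) :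
    IsWeakGradient Ω (fun x => u₁ x + u₂ x) (fun x => g₁ x + g₂ x) := by
  intro φ hφ v
  have hφ2 : MemLp φ 2 (volume.restrict Ω) :=
    (hφ.1.continuous.memLp_of_hasCompactSupport hφ.2.1).restrict Ω
  have hd2 : MemLp (fun x => fderiv ℝ φ x v) 2 (volume.restrict Ω) :=
    (((hφ.1.continuous_fderiv (by simp)).clm_apply
      continuous_const).memLp_of_hasCompactSupport (hφ.2.1.fderiv_apply ℝ v)).restrict Ω
  simp only [inner_add_left, add_mul]
  have e₁ : ∫ x in Ω, (u₁ x * fderiv ℝ φ x v + u₂ x * fderiv ℝ φ x v) = _ :=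
    integral_add (hu₁.integrable_mul hd2) (hu₂.integrable_mul hd2)
  have e₂ : ∫ x in Ω, (⟪g₁ x, v⟫ * φ x + ⟪g₂ x, v⟫ * φ x) = _ :=
    integral_add ((hg₁.inner_const v).integrable_mul hφ2)
      ((hg₂.inner_const v).integrable_mul hφ2)
  refine e₁.trans (Eq.trans ?_ (congrArg Neg.neg e₂).symm)
  exact (congrArg₂ (· + ·) (h₁ φ hφ v) (h₂ φ hφ v)).trans (neg_add _ _).symm

end Helpers

variable {d : ℕ}

/-- The Hilbert space `H¹(Ω)`, realised as the space of the pairs `(u, ∇u)` in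
`L²(Ω) × L²(Ω)^d` (for `Ω` open, `∇u` is determined by `u`). The norm is
`‖u‖² = ‖u‖_{L²}² + ‖∇u‖_{L²}²`. -/
def H1 (Ω : Set (EuclideanSpace ℝ (Fin d))) :
    Submodule ℝ (WithLp 2 (Lp ℝ 2 (volume.restrict Ω) ×
      Lp (EuclideanSpace ℝ (Fin d)) 2 (volume.restrict Ω))) where
  carrier := {p | IsWeakGradient Ω p.fst p.snd}
  zero_mem' := (IsWeakGradient.zero Ω).congr (Lp.coeFn_zero _ _ _) (Lp.coeFn_zero _ _ _)
  add_mem' := fun {p q} hp hq =>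
    (IsWeakGradient.add (Lp.memLp p.fst) (Lp.memLp q.fst) (Lp.memLp p.snd) (Lp.memLp q.snd)
      hp hq).congr (Lp.coeFn_add _ _) (Lp.coeFn_add _ _)
  smul_mem' := fun c p hp =>
    (IsWeakGradient.const_smul (u := p.fst) (g := p.snd) hp c).congr
      (Lp.coeFn_smul c p.fst) (Lp.coeFn_smul c p.snd)

/-- A representative of `u ∈ H¹(Ω)`; only its values almost everywhere in `Ω` are meaningful. -/
def h1Rep {Ω : Set (EuclideanSpace ℝ (Fin d))} (u : H1 Ω) : EuclideanSpace ℝ (Fin d) → ℝ :=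
  u.1.fst

/-- `H̃¹(Ω)`: the closure in `H¹(Ω)` of `H¹(Ω) ∩ C⁰(closure Ω)`. -/
def H1tilde (Ω : Set (EuclideanSpace ℝ (Fin d))) : Set (H1 Ω) :=
  closure {u | ∃ f : EuclideanSpace ℝ (Fin d) → ℝ,
    ContinuousOn f (closure Ω) ∧ h1Rep u =ᵐ[volume.restrict Ω] f}

/-! ## Directional measures, directional traces and omnidirectional traces -/

/-- `δ_θ(x) = sup {s ≥ 0 : x + tθ ∈ Ω for all t ∈ [0, s)}`. -/
def exitTime (Ω : Set (EuclideanSpace ℝ (Fin d))) (θ x : EuclideanSpace ℝ (Fin d)) : ℝ :=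
  sSup {s : ℝ | 0 ≤ s ∧ ∀ t ∈ Ico 0 s, x + t • θ ∈ Ω}

/-- `Φ_θ(x) = x + δ_θ(x) θ`, the boundary point that `x ∈ Ω` sees in the direction `θ`. -/
def exitPoint (Ω : Set (EuclideanSpace ℝ (Fin d))) (θ x : EuclideanSpace ℝ (Fin d)) :
    EuclideanSpace ℝ (Fin d) :=
  x + exitTime Ω θ x • θ

/-- The directional measure `μ_θ(A) = |{x ∈ Ω : Φ_θ(x) ∈ A}|`, regarded as a measure on the whole
space that is carried by `∂Ω`. -/
def directionalMeasure (Ω : Set (EuclideanSpace ℝ (Fin d))) (θ : EuclideanSpace ℝ (Fin d)) :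
    Measure (EuclideanSpace ℝ (Fin d)) :=
  (volume.restrict Ω).map (exitPoint Ω θ)

/-- `P_θ(x) = x - (x · θ) θ`, the orthogonal projection on the hyperplane orthogonal to the unit
vector `θ`. -/
def hyperplaneProj (θ x : EuclideanSpace ℝ (Fin d)) : EuclideanSpace ℝ (Fin d) :=
  x - ⟪x, θ⟫ • θ

/-- `ω_θ(y) = {s : sθ + y ∈ Ω}`. -/
def lineSection (Ω : Set (EuclideanSpace ℝ (Fin d))) (θ y : EuclideanSpace ℝ (Fin d)) : Set ℝ :=
  {s | s • θ + y ∈ Ω}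

/-- `g` is a directional trace of `u` on `∂Ω` in the direction `θ` (only the values of `g` on `∂Ω`
are used): for a representative `u'` of `u` and for almost all `y ∈ P_θ(Ω)`, the function
`s ↦ u'(sθ + y)` belongs to `H¹(ω_θ(y))`, and at the right end `β` of each of the maximal intervals
`(α, β)` of `ω_θ(y)` the value of `g` is that of its representative `f` which is continuous on
`(α, β]`. Negligibility with respect to the `(d-1)`-dimensional Lebesgue measure of the hyperplane
orthogonal to `θ` is expressed by the `(d-1)`-dimensional Hausdorff measure. -/
def IsDirectionalTrace (Ω : Set (EuclideanSpace ℝ (Fin d))) (θ : EuclideanSpace ℝ (Fin d))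
    (u g : EuclideanSpace ℝ (Fin d) → ℝ) : Prop :=
  ∃ u' : EuclideanSpace ℝ (Fin d) → ℝ, u' =ᵐ[volume.restrict Ω] u ∧
    ∃ A ⊆ hyperplaneProj θ '' Ω,
      Measure.hausdorffMeasure ((d : ℝ) - 1) ((hyperplaneProj θ '' Ω) \ A) = 0 ∧
      ∀ y ∈ A, MemH1 (lineSection Ω θ y) (fun s : ℝ => u' (s • θ + y)) ∧
        ∀ α β : ℝ, α < β → Ioo α β ⊆ lineSection Ω θ y → α ∉ lineSection Ω θ y →
          β ∉ lineSection Ω θ y →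
          ∃ f : ℝ → ℝ, ContinuousOn f (Ioc α β) ∧
            (∀ᵐ s ∂volume.restrict (Ioo α β), f s = u' (s • θ + y)) ∧
            g (β • θ + y) = f β

/-- The functions on `∂Ω` that belong to `L²(∂Ω, μ_θ)` for all unit vectors `θ`, with a norm
bounded independently of `θ`. -/
def MemL2Directional (Ω : Set (EuclideanSpace ℝ (Fin d))) (g : EuclideanSpace ℝ (Fin d) → ℝ) :
    Prop :=
  ∃ M : ℝ, ∀ θ ∈ Metric.sphere (0 : EuclideanSpace ℝ (Fin d)) 1,
    MemLp g 2 (directionalMeasure Ω θ) ∧ ∫ z, g z ^ 2 ∂(directionalMeasure Ω θ) ≤ M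

/-- `g` is an omnidirectional trace of `u`: for every direction `θ`, the directional trace
of `u` is equal to `g` almost everywhere for `μ_θ`. -/
def IsOmnidirectionalTrace (Ω : Set (EuclideanSpace ℝ (Fin d)))
    (u g : EuclideanSpace ℝ (Fin d) → ℝ) : Prop :=
  MemL2Directional Ω g ∧
    ∀ θ ∈ Metric.sphere (0 : EuclideanSpace ℝ (Fin d)) 1,
      ∃ γ : EuclideanSpace ℝ (Fin d) → ℝ,
        IsDirectionalTrace Ω θ u γ ∧ γ =ᵐ[directionalMeasure Ω θ] g

/-- `H¹_tr(Ω)`: the elements of `H¹(Ω)` that have an omnidirectional trace on `∂Ω`. -/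
def H1tr (Ω : Set (EuclideanSpace ℝ (Fin d))) : Set (H1 Ω) :=
  {u | ∃ g : EuclideanSpace ℝ (Fin d) → ℝ, IsOmnidirectionalTrace Ω (h1Rep u) g}

/-! ## The domain -/

/-- The cone `K_a` with vertex `(a, 0)`, angle `π/2` and height `1`. -/
def cone (a : ℝ) : Set (EuclideanSpace ℝ (Fin 2)) :=
  {x | 0 < x 1 ∧ x 1 < 1 ∧ |x 0 - a| < x 1}

/-- The union of the cones whose vertices are the points of the middle-third Cantor set. -/
def monoconeDomain : Set (EuclideanSpace ℝ (Fin 2)) :=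
  ⋃ a ∈ cantorSet, cone a

/-- The symmetry `ψ(x, y) = (x, -y)`. -/
def reflect (x : EuclideanSpace ℝ (Fin 2)) : EuclideanSpace ℝ (Fin 2) :=
  !₂[x 0, -x 1]

/-- The union of the cones over the Cantor set and of their mirror images. -/
def biconeDomain : Set (EuclideanSpace ℝ (Fin 2)) :=
  monoconeDomain ∪ reflect '' monoconeDomain

/-! ## Averages over horizontal lines -/

/-- The height `y_n = 3^{-n} / 2`. -/
def lineHeight (n : ℕ) : ℝ := (3 : ℝ)⁻¹ ^ n / 2

/-- `D_n = {x : (x, y_n) ∈ Ω_C}`. -/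
def lineDomain (n : ℕ) : Set ℝ := {x | !₂[x, lineHeight n] ∈ monoconeDomain}

/-- `t` is the trace of `u` on `D × {c}`: for almost all `x ∈ D`, the continuous representative
near `c` of `y ↦ u(x, y)` takes at `c` the value `t x`, that is, `t x` is the essential limit
of `u(x, y)` as `y → c`. -/
def IsHorizontalTrace (u : EuclideanSpace ℝ (Fin 2) → ℝ) (c : ℝ) (D : Set ℝ) (t : ℝ → ℝ) : Prop :=
  ∀ᵐ x ∂volume.restrict D, Tendsto (fun y : ℝ => u !₂[x, y]) (𝓝 c ⊓ ae volume) (𝓝 (t x))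

/-- `L` is the linear form `u ↦ |D|⁻¹ ∫_D u(x, c) dx` on `H¹(Ω)`: each `u` has a trace on
`D × {c}`, integrable over `D`, and `L u` is the average of this trace. -/
def IsHorizontalAverage (Ω : Set (EuclideanSpace ℝ (Fin 2))) (c : ℝ) (D : Set ℝ)
    (L : H1 Ω →L[ℝ] ℝ) : Prop :=
  ∀ u : H1 Ω, ∃ t : ℝ → ℝ, IsHorizontalTrace (h1Rep u) c D t ∧ IntegrableOn t D ∧
    L u = (volume.real D)⁻¹ * ∫ x in D, t x

end

noncomputable section

/-!
The averages `νₙ` converge because `Dₙ₊₁` consists of two copies of `Dₙ` scaled by `1/3`. The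
fundamental theorem of calculus on vertical segments compares the trace at height `yₙ` with means
over the strip above it, and on horizontal segments it compares the means over the pieces of the
strip over the two copies. By the Cauchy-Schwarz inequality the resulting error is of the order of
the square root of `yₙ / |Dₙ|` times the norm of `v`, and this decays like `(√2 / 2) ^ n`.

A function that is continuous up to the boundary takes nearly the same values at `(x, yₙ)` and
`(x, -yₙ)`, so `ν̄ - ν̄_ψ` vanishes on `H̃¹(Ω)`, whereas it is `2` at `û`. The two halves of `Ω`
only touch along the Cantor set, which is Lebesgue null, as are its projections along any
direction. Almost every line therefore misses it, and along such a line `û` is locally constant up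
to the boundary; hence `û` has itself as an omnidirectional trace.
-/

/-! ## Cones over the Cantor set -/

lemma isOpen_cone (a : ℝ) : IsOpen (cone a) := by
  have hpos : IsOpen {x : EuclideanSpace ℝ (Fin 2) | 0 < x 1} :=
    isOpen_lt (by fun_prop) (by fun_prop)
  have hlt : IsOpen {x : EuclideanSpace ℝ (Fin 2) | x 1 < 1} :=
    isOpen_lt (by fun_prop) (by fun_prop)
  have habs : IsOpen {x : EuclideanSpace ℝ (Fin 2) | |x 0 - a| < x 1} :=
    isOpen_lt (by fun_prop) (by fun_prop)
  exact hpos.inter (hlt.inter habs)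

lemma isOpen_monoconeDomain : IsOpen monoconeDomain :=
  isOpen_biUnion fun a _ => isOpen_cone a

lemma mem_monoconeDomain_iff {x : EuclideanSpace ℝ (Fin 2)} :
    x ∈ monoconeDomain ↔ 0 < x 1 ∧ x 1 < 1 ∧ x 0 ∈ Metric.thickening (x 1) cantorSet := by
  simp only [monoconeDomain, mem_iUnion, cone, mem_ofPred_eq, exists_prop,
    Metric.mem_thickening_iff, Real.dist_eq]
  grind

@[simp] lemma reflect_zero (x : EuclideanSpace ℝ (Fin 2)) : reflect x 0 = x 0 := by simp [reflect]

@[simp] lemma reflect_one (x : EuclideanSpace ℝ (Fin 2)) : reflect x 1 = -x 1 := by simp [reflect]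

lemma reflect_involutive : Function.Involutive reflect := fun x => by
  ext i; fin_cases i <;> simp

lemma norm_reflect (x : EuclideanSpace ℝ (Fin 2)) : ‖reflect x‖ = ‖x‖ := by
  simp [EuclideanSpace.norm_eq]

/-- The symmetry `ψ` as a linear isometry of the plane. -/
def reflectIsometry : EuclideanSpace ℝ (Fin 2) ≃ₗᵢ[ℝ] EuclideanSpace ℝ (Fin 2) where
  toFun := reflect
  invFun := reflect
  left_inv := reflect_involutive
  right_inv := reflect_involutive
  map_add' x y := by ext i; fin_cases i <;> simp [add_comm]
  map_smul' c x := by ext i; fin_cases i <;> simp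
  norm_map' := norm_reflect

lemma reflect_image (s : Set (EuclideanSpace ℝ (Fin 2))) : reflect '' s = reflect ⁻¹' s :=
  congrFun (image_eq_preimage_of_inverse reflect_involutive reflect_involutive) s

lemma preimage_reflect_biconeDomain : reflect ⁻¹' biconeDomain = biconeDomain := by
  rw [biconeDomain, preimage_union, reflect_image, ← preimage_comp, reflect_involutive.comp_self,
    preimage_id, union_comm]

lemma mem_biconeDomain_iff {x : EuclideanSpace ℝ (Fin 2)} :
    x ∈ biconeDomain ↔
      0 < |x 1| ∧ |x 1| < 1 ∧ x 0 ∈ Metric.thickening |x 1| cantorSet := by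
  rw [biconeDomain, reflect_image, mem_union, mem_preimage, mem_monoconeDomain_iff,
    mem_monoconeDomain_iff, reflect_zero, reflect_one]
  grind

lemma isOpen_biconeDomain : IsOpen biconeDomain := by
  rw [biconeDomain, reflect_image]
  exact isOpen_monoconeDomain.union
    (isOpen_monoconeDomain.preimage reflectIsometry.continuous)

lemma thickening_cantorSet_subset (s : ℝ) :
    Metric.thickening s cantorSet ⊆ Ioo (-s) (1 + s) := by
  intro x hx
  obtain ⟨a, ha, hxa⟩ := Metric.mem_thickening_iff.1 hx
  have ha' := cantorSet_subset_unitInterval ha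
  rw [Real.dist_eq, abs_lt] at hxa
  exact ⟨by linarith [ha'.1], by linarith [ha'.2]⟩

lemma isBounded_biconeDomain : Bornology.IsBounded biconeDomain := by
  refine isBounded_iff_forall_norm_le.2 ⟨3, fun x hx => ?_⟩
  obtain ⟨-, hlt, hx0⟩ := mem_biconeDomain_iff.1 hx
  have hx0 := thickening_cantorSet_subset _ hx0
  have habs : |x 0| ≤ 2 := abs_le.2 ⟨by linarith [hx0.1], by linarith [hx0.2]⟩
  rw [EuclideanSpace.norm_eq, Real.sqrt_le_left (by norm_num)]
  simp only [Fin.sum_univ_two, Real.norm_eq_abs]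
  nlinarith [abs_nonneg (x 0), abs_nonneg (x 1)]

lemma lineHeight_pos (n : ℕ) : 0 < lineHeight n := by unfold lineHeight; positivity

lemma lineHeight_succ (n : ℕ) : lineHeight (n + 1) = lineHeight n / 3 := by
  unfold lineHeight; rw [pow_succ]; ring

lemma lineHeight_le (n : ℕ) : lineHeight n ≤ 1 / 2 := by
  unfold lineHeight
  have : (3 : ℝ)⁻¹ ^ n ≤ 1 := pow_le_one₀ (by norm_num) (by norm_num)
  linarith

lemma lineDomain_eq_thickening (n : ℕ) :
    lineDomain n = Metric.thickening (lineHeight n) cantorSet := by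
  ext x
  have hpos := lineHeight_pos n
  have hle := lineHeight_le n
  simp only [lineDomain, mem_ofPred_eq, mem_monoconeDomain_iff, Matrix.cons_val_zero,
    Matrix.cons_val_one, Matrix.cons_val_fin_one]
  exact ⟨fun h => h.2.2, fun h => ⟨hpos, by linarith, h⟩⟩

lemma isOpen_lineDomain (n : ℕ) : IsOpen (lineDomain n) := by
  rw [lineDomain_eq_thickening]; exact Metric.isOpen_thickening

lemma measurableSet_lineDomain (n : ℕ) : MeasurableSet (lineDomain n) :=
  (isOpen_lineDomain n).measurableSet

lemma cantorSet_subset_lineDomain (n : ℕ) : cantorSet ⊆ lineDomain n := by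
  rw [lineDomain_eq_thickening]
  exact Metric.self_subset_thickening (lineHeight_pos n) _

lemma lineDomain_succ_subset (n : ℕ) : lineDomain (n + 1) ⊆ lineDomain n := by
  rw [lineDomain_eq_thickening, lineDomain_eq_thickening]
  refine Metric.thickening_mono ?_ _
  rw [lineHeight_succ]; linarith [lineHeight_pos n]

lemma lineDomain_subset (n : ℕ) : lineDomain n ⊆ Ioo (-(1 / 2)) (3 / 2) := by
  rw [lineDomain_eq_thickening]
  refine (thickening_cantorSet_subset _).trans (Ioo_subset_Ioo ?_ ?_) <;> linarith [lineHeight_le n]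

lemma volume_lineDomain_ne_top (n : ℕ) : volume (lineDomain n) ≠ ⊤ :=
  measure_ne_top_of_subset (lineDomain_subset n) (by simp)

/-! ## Self-similarity -/

/-- The two similarities of the Cantor set: `z ↦ z / 3` for `b = 0` and `z ↦ (2 + z) / 3` for
`b = 2`. -/
def cantorContraction (b : ℕ) (z : ℝ) : ℝ := (b + z) / 3

lemma cantorSet_eq_union_image :
    cantorSet = cantorContraction 0 '' cantorSet ∪ cantorContraction 2 '' cantorSet := by
  have h0 : cantorContraction 0 = (· / 3) := by ext z; simp [cantorContraction]
  have h2 : cantorContraction 2 = fun z => (2 + z) / 3 := by ext z; simp [cantorContraction]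
  rw [h0, h2]
  exact cantorSet_eq_union_halves

lemma cantorContraction_injective (b : ℕ) : Function.Injective (cantorContraction b) := by
  intro x y h
  simpa [cantorContraction] using h

lemma cantorContraction_three_mul_sub (b : ℕ) (x : ℝ) : cantorContraction b (3 * x - b) = x := by
  simp [cantorContraction]

lemma hasDerivAt_cantorContraction (b : ℕ) (z : ℝ) :
    HasDerivAt (cantorContraction b) (1 / 3) z :=
  ((hasDerivAt_id z).const_add (b : ℝ)).div_const 3

lemma dist_cantorContraction (b : ℕ) (x y : ℝ) :
    dist (cantorContraction b x) (cantorContraction b y) = dist x y / 3 := by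
  simp only [Real.dist_eq, cantorContraction]
  rw [← sub_div, abs_div, abs_of_pos (by norm_num : (0 : ℝ) < 3)]
  ring_nf

lemma thickening_image_cantorContraction (b : ℕ) (s : ℝ) (S : Set ℝ) :
    Metric.thickening (s / 3) (cantorContraction b '' S) =
      cantorContraction b '' Metric.thickening s S := by
  ext x
  simp only [Metric.mem_thickening_iff, mem_image, exists_exists_and_eq_and]
  constructor
  · rintro ⟨a, ha, hxa⟩
    refine ⟨3 * x - b, ⟨a, ha, ?_⟩, cantorContraction_three_mul_sub b x⟩
    rw [← cantorContraction_three_mul_sub b x, dist_cantorContraction] at hxa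
    linarith
  · rintro ⟨z, ⟨a, ha, hza⟩, rfl⟩
    refine ⟨a, ha, ?_⟩
    rw [dist_cantorContraction]
    linarith

lemma lineDomain_succ (n : ℕ) :
    lineDomain (n + 1) =
      cantorContraction 0 '' lineDomain n ∪ cantorContraction 2 '' lineDomain n := by
  rw [lineDomain_eq_thickening, lineDomain_eq_thickening, lineHeight_succ]
  conv_lhs => rw [cantorSet_eq_union_image]
  rw [Metric.thickening_union, thickening_image_cantorContraction,
    thickening_image_cantorContraction]

lemma one_mem_cantorSet : (1 : ℝ) ∈ cantorSet := by
  refine mem_iInter.2 fun n => ?_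
  induction n with
  | zero => simp
  | succ n ih => exact Or.inr ⟨1, ih, by norm_num⟩

lemma lineDomain_zero : lineDomain 0 = Ioo (-(1 / 2)) (3 / 2) := by
  refine (lineDomain_subset 0).antisymm fun x hx => ?_
  have h0 : lineHeight 0 = 1 / 2 := by simp [lineHeight]
  rw [lineDomain_eq_thickening, h0, Metric.mem_thickening_iff]
  simp only [Real.dist_eq, abs_lt]
  rcases le_total x (1 / 4) with h | h
  · exact ⟨0, zero_mem_cantorSet, by linarith [hx.1], by linarith⟩
  rcases le_total x (3 / 5) with h' | h'
  · exact ⟨1 / 4, quarter_mem_cantorSet, by linarith, by linarith⟩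
  · exact ⟨1, one_mem_cantorSet, by linarith, by linarith [hx.2]⟩

lemma disjoint_image_lineDomain (n : ℕ) :
    Disjoint (cantorContraction 0 '' lineDomain n) (cantorContraction 2 '' lineDomain n) := by
  refine disjoint_left.2 ?_
  rintro _ ⟨z, hz, rfl⟩ ⟨w, hw, hzw⟩
  have hz := (lineDomain_subset n hz).2
  have hw := (lineDomain_subset n hw).1
  simp only [cantorContraction, Nat.cast_zero, Nat.cast_ofNat] at hzw
  linarith

lemma measurableSet_image_cantorContraction (b : ℕ) {S : Set ℝ} (hS : MeasurableSet S) :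
    MeasurableSet (cantorContraction b '' S) :=
  measurable_image_of_fderivWithin hS
    (fun x _ => (hasDerivAt_cantorContraction b x).hasFDerivAt.hasFDerivWithinAt)
    (cantorContraction_injective b).injOn

lemma integrableOn_image_cantorContraction_iff (b : ℕ) {S : Set ℝ} (hS : MeasurableSet S)
    {F : ℝ → ℝ} :
    IntegrableOn F (cantorContraction b '' S) ↔ IntegrableOn (F ∘ cantorContraction b) S := by
  rw [integrableOn_image_iff_integrableOn_abs_deriv_smul hS
    (fun x _ => (hasDerivAt_cantorContraction b x).hasDerivWithinAt)
    (cantorContraction_injective b).injOn]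
  exact integrable_smul_iff (c := |(1 / 3 : ℝ)|) (by norm_num) _

lemma setIntegral_image_cantorContraction (b : ℕ) {S : Set ℝ} (hS : MeasurableSet S)
    (F : ℝ → ℝ) :
    ∫ x in cantorContraction b '' S, F x = (∫ z in S, F (cantorContraction b z)) / 3 := by
  rw [integral_image_eq_integral_abs_deriv_smul hS
    (fun x _ => (hasDerivAt_cantorContraction b x).hasDerivWithinAt)
    (cantorContraction_injective b).injOn, integral_smul]
  norm_num
  ring

lemma integrableOn_lineDomain_succ_iff {n : ℕ} {F : ℝ → ℝ} :
    IntegrableOn F (lineDomain (n + 1)) ↔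
      IntegrableOn (F ∘ cantorContraction 0) (lineDomain n) ∧
        IntegrableOn (F ∘ cantorContraction 2) (lineDomain n) := by
  rw [lineDomain_succ, integrableOn_union,
    integrableOn_image_cantorContraction_iff 0 (measurableSet_lineDomain n),
    integrableOn_image_cantorContraction_iff 2 (measurableSet_lineDomain n)]

lemma setIntegral_lineDomain_succ {n : ℕ} {F : ℝ → ℝ}
    (hF : IntegrableOn F (lineDomain (n + 1))) :
    ∫ x in lineDomain (n + 1), F x =
      ((∫ z in lineDomain n, F (cantorContraction 0 z)) +
        ∫ z in lineDomain n, F (cantorContraction 2 z)) / 3 := by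
  rw [lineDomain_succ, integrableOn_union] at hF
  rw [lineDomain_succ, setIntegral_union (disjoint_image_lineDomain n)
    (measurableSet_image_cantorContraction 2 (measurableSet_lineDomain n)) hF.1 hF.2,
    setIntegral_image_cantorContraction 0 (measurableSet_lineDomain n),
    setIntegral_image_cantorContraction 2 (measurableSet_lineDomain n), add_div]

lemma volume_real_lineDomain (n : ℕ) : volume.real (lineDomain n) = 2 * (2 / 3) ^ n := by
  induction n with
  | zero => rw [lineDomain_zero]; norm_num [Measure.real]
  | succ n ih =>
    have h := setIntegral_lineDomain_succ (n := n) (F := fun _ => (1 : ℝ))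
      (integrableOn_const (volume_lineDomain_ne_top _))
    simp only [setIntegral_const, smul_eq_mul, mul_one] at h
    rw [h, ih, pow_succ]; ring

lemma volume_real_lineDomain_pos (n : ℕ) : 0 < volume.real (lineDomain n) := by
  rw [volume_real_lineDomain]; positivity

lemma volume_lineDomain_ne_zero (n : ℕ) : volume (lineDomain n) ≠ 0 := fun h =>
  (volume_real_lineDomain_pos n).ne' (by rw [Measure.real, h, ENNReal.toReal_zero])

lemma volume_cantorSet : volume cantorSet = 0 := by
  have hlim : Tendsto (fun n : ℕ => 2 * (2 / 3 : ℝ) ^ n) atTop (𝓝 (2 * 0)) :=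
    (tendsto_pow_atTop_nhds_zero_of_lt_one (by norm_num) (by norm_num)).const_mul 2
  have hle (n : ℕ) : volume.real cantorSet ≤ 2 * (2 / 3) ^ n := by
    rw [← volume_real_lineDomain]
    exact measureReal_mono (cantorSet_subset_lineDomain n) (volume_lineDomain_ne_top n)
  have hfin : volume cantorSet ≠ ⊤ := isCompact_cantorSet.measure_ne_top
  rw [← measureReal_eq_zero_iff hfin]
  exact le_antisymm ((ge_of_tendsto' hlim hle).trans_eq (mul_zero 2)) measureReal_nonneg

lemma setAverage_lineDomain_succ {n : ℕ} {f : ℝ → ℝ} (hf : IntegrableOn f (lineDomain (n + 1))) :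
    ⨍ x in lineDomain (n + 1), f x =
      ((⨍ z in lineDomain n, f (cantorContraction 0 z)) +
        ⨍ z in lineDomain n, f (cantorContraction 2 z)) / 2 := by
  have hinv : (volume.real (lineDomain (n + 1)))⁻¹ = 3 / 2 * (volume.real (lineDomain n))⁻¹ := by
    rw [volume_real_lineDomain, volume_real_lineDomain, pow_succ]; field_simp
  simp only [setAverage_eq, smul_eq_mul, setIntegral_lineDomain_succ hf, hinv]
  ring

/-- The function `f` is a primitive of `g` on the open set `D`, up to null sets. The condition is
imposed on intervals with rational ends only: there are countably many of them, so that it can be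
checked on almost every line at once. -/
def IsPrimitiveOn (D : Set ℝ) (f g : ℝ → ℝ) : Prop :=
  ∀ a b : ℚ, (a : ℝ) < b → Ioo (a : ℝ) b ⊆ D →
    ∃ k : ℝ, ∀ᵐ x ∂volume.restrict (Ioo (a : ℝ) b), f x = k + ∫ s in (a : ℝ)..x, g s

lemma quasiMeasurePreserving_cantorContraction (b : ℕ) :
    Measure.QuasiMeasurePreserving (cantorContraction b) volume volume := by
  have hscale : Measure.QuasiMeasurePreserving (fun z : ℝ => 3⁻¹ * z) volume volume := by
    refine ⟨by fun_prop, ?_⟩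
    rw [Real.map_volume_mul_left (by norm_num)]
    exact Measure.smul_absolutelyContinuous
  convert hscale.comp (measurePreserving_add_left volume (b : ℝ)).quasiMeasurePreserving using 1
  ext z; simp [cantorContraction]; ring

lemma IsPrimitiveOn.comp_cantorContraction {S D : Set ℝ} {f g : ℝ → ℝ} (h : IsPrimitiveOn D f g)
    (b : ℕ) (hS : cantorContraction b '' S ⊆ D) :
    IsPrimitiveOn S (f ∘ cantorContraction b) (fun z => g (cantorContraction b z) / 3) := by
  have hlt {x y : ℝ} (hxy : x < y) : cantorContraction b x < cantorContraction b y := by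
    unfold cantorContraction; linarith
  intro p q hpq hpqS
  have hcast (r : ℚ) : (((b + r) / 3 : ℚ) : ℝ) = cantorContraction b r := by
    simp [cantorContraction]
  obtain ⟨k, hk⟩ := h ((b + p) / 3) ((b + q) / 3) (by rw [hcast, hcast]; exact hlt hpq) (by
    rw [hcast, hcast]
    intro x hx
    refine hS ⟨3 * x - b, hpqS ?_, cantorContraction_three_mul_sub b x⟩
    simp only [cantorContraction, mem_Ioo] at hx
    constructor <;> linarith [hx.1, hx.2])
  refine ⟨k, ?_⟩
  rw [hcast, hcast, ae_restrict_iff' measurableSet_Ioo] at hk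
  rw [ae_restrict_iff' measurableSet_Ioo]
  filter_upwards [(quasiMeasurePreserving_cantorContraction b).ae hk] with z hz hzpq
  rw [Function.comp_apply, hz ⟨hlt hzpq.1, hlt hzpq.2⟩, intervalIntegral.integral_div]
  have hsubst := intervalIntegral.integral_comp_add_div g (by norm_num : (3 : ℝ) ≠ 0) ((b : ℝ) / 3)
    (a := p) (b := z)
  simp only [cantorContraction, add_div, hsubst, smul_eq_mul]
  ring

lemma abs_integral_le_setIntegral_Ioo {a b x : ℝ} {g : ℝ → ℝ} (hx : x ∈ Ioo a b)
    (hg : IntegrableOn g (Ioo a b)) : |∫ s in a..x, g s| ≤ ∫ s in Ioo a b, |g s| := by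
  refine (intervalIntegral.abs_integral_le_integral_abs hx.1.le).trans ?_
  rw [intervalIntegral.integral_of_le hx.1.le, ← integral_Ioc_eq_integral_Ioo]
  exact setIntegral_mono_set ((integrableOn_Ioc_iff_integrableOn_Ioo).2 hg).abs
    (ae_of_all _ fun _ => abs_nonneg _) (Ioc_subset_Ioc_right hx.2.le).eventuallyLE

lemma abs_setAverage_lineDomain_zero_sub_one_le {f g : ℝ → ℝ}
    (hf : IntegrableOn f (lineDomain 0)) (hg : IntegrableOn g (lineDomain 0))
    (hfg : IsPrimitiveOn (lineDomain 0) f g) :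
    |(⨍ x in lineDomain 0, f x) - ⨍ x in lineDomain 1, f x| ≤
      2 * ∫ x in lineDomain 0, |g x| := by
  have hD : Ioo ((-(1 / 2) : ℚ) : ℝ) ((3 / 2 : ℚ) : ℝ) = lineDomain 0 := by
    rw [lineDomain_zero]; push_cast; rfl
  obtain ⟨k, hk⟩ := hfg (-(1 / 2)) (3 / 2) (by norm_num) hD.subset
  rw [hD] at hk
  have hball : ∀ᵐ x ∂volume.restrict (lineDomain 0),
      f x ∈ Metric.closedBall k (∫ x in lineDomain 0, |g x|) := by
    filter_upwards [hk, ae_restrict_mem (measurableSet_lineDomain 0)] with x hx hxD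
    rw [Metric.mem_closedBall, Real.dist_eq, hx, add_sub_cancel_left]
    rw [← hD] at hxD hg ⊢
    exact abs_integral_le_setIntegral_Ioo hxD hg
  have h0 := (convex_closedBall k _).set_average_mem Metric.isClosed_closedBall
    (volume_lineDomain_ne_zero 0) (volume_lineDomain_ne_top 0) hball hf
  have h1 := (convex_closedBall k _).set_average_mem Metric.isClosed_closedBall
    (volume_lineDomain_ne_zero 1) (volume_lineDomain_ne_top 1)
    (ae_restrict_of_ae_restrict_of_subset (lineDomain_succ_subset 0) hball)
    (hf.mono_set (lineDomain_succ_subset 0))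
  rw [two_mul, ← Real.dist_eq]
  exact dist_triangle_right _ _ k |>.trans (add_le_add h0 h1)

lemma abs_setAverage_lineDomain_sub_succ_le (n : ℕ) {f g : ℝ → ℝ}
    (hf : IntegrableOn f (lineDomain n)) (hg : IntegrableOn g (lineDomain n))
    (hfg : IsPrimitiveOn (lineDomain n) f g) :
    |(⨍ x in lineDomain n, f x) - ⨍ x in lineDomain (n + 1), f x| ≤
      2 * (1 / 2) ^ n * ∫ x in lineDomain n, |g x| := by
  induction n generalizing f g with
  | zero => simpa using abs_setAverage_lineDomain_zero_sub_one_le hf hg hfg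
  | succ n ih =>
    have hf' := integrableOn_lineDomain_succ_iff.1 hf
    have hg' := integrableOn_lineDomain_succ_iff.1 hg
    have hsub := lineDomain_succ n
    have h0 := ih hf'.1 (hg'.1.div_const 3)
      (hfg.comp_cantorContraction 0 (hsub ▸ subset_union_left))
    have h2 := ih hf'.2 (hg'.2.div_const 3)
      (hfg.comp_cantorContraction 2 (hsub ▸ subset_union_right))
    rw [setAverage_lineDomain_succ hf,
      setAverage_lineDomain_succ (hf.mono_set (lineDomain_succ_subset (n + 1))),
      setIntegral_lineDomain_succ hg.abs, ← sub_div, abs_div, abs_two, add_sub_add_comm]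
    simp only [Function.comp_apply, abs_div, Nat.abs_ofNat, integral_div] at h0 h2
    calc _ ≤ _ := div_le_div_of_nonneg_right ((abs_add_le _ _).trans (add_le_add h0 h2)) two_pos.le
      _ = _ := by rw [pow_succ]; ring

/-! ## Test functions -/

namespace IsTestFunction

variable {E : Type*} [NormedAddCommGroup E] [InnerProductSpace ℝ E] {Ω : Set E} {φ χ : E → ℝ}

lemma eq_zero (hφ : IsTestFunction Ω φ) {x : E} (hx : x ∉ Ω) : φ x = 0 :=
  image_eq_zero_of_notMem_tsupport fun h => hx (hφ.2.2 h)

lemma const_mul (hφ : IsTestFunction Ω φ) (c : ℝ) : IsTestFunction Ω (fun x => c * φ x) :=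
  ⟨contDiff_const.mul hφ.1, hφ.2.1.mul_left, (tsupport_mul_subset_right).trans hφ.2.2⟩

lemma sub (hφ : IsTestFunction Ω φ) (hχ : IsTestFunction Ω χ) :
    IsTestFunction Ω (fun x => φ x - χ x) :=
  ⟨hφ.1.sub hχ.1, hφ.2.1.sub hχ.2.1, (tsupport_sub φ χ).trans (union_subset hφ.2.2 hχ.2.2)⟩

protected lemma deriv {U : Set ℝ} {β : ℝ → ℝ} (hβ : IsTestFunction U β) :
    IsTestFunction U (deriv β) :=
  ⟨(contDiff_infty_iff_deriv.1 hβ.1).2, hβ.2.1.deriv, (tsupport_deriv_subset).trans hβ.2.2⟩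

lemma integrable_mul_comp [MeasurableSpace E] [BorelSpace E] {X : Type*} [MeasurableSpace X]
    {μ : Measure X} {u : X → ℝ} {p : X → E} (hφ : IsTestFunction Ω φ) (hu : Integrable u μ)
    (hp : Measurable p) : Integrable (fun x => u x * φ (p x)) μ := by
  obtain ⟨C, hC⟩ := hφ.2.1.exists_bound_of_continuous hφ.1.continuous
  exact hu.mul_bdd (c := C) (hφ.1.continuous.measurable.comp hp).aestronglyMeasurable
    (ae_of_all _ fun x => hC (p x))

lemma integrable [MeasurableSpace E] [BorelSpace E] {μ : Measure E} [IsFiniteMeasureOnCompacts μ]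
    (hφ : IsTestFunction Ω φ) : Integrable φ μ :=
  hφ.1.continuous.integrable_of_hasCompactSupport hφ.2.1

lemma integrable_mul [MeasurableSpace E] [BorelSpace E] {μ : Measure E} {u : E → ℝ}
    (hφ : IsTestFunction Ω φ) (hu : Integrable u μ) : Integrable (fun x => u x * φ x) μ :=
  hφ.integrable_mul_comp hu measurable_id

end IsTestFunction

lemma exists_isTestFunction_Ioo_integral_eq_one {c d : ℝ} (hcd : c < d) :
    ∃ χ : ℝ → ℝ, IsTestFunction (Ioo c d) χ ∧ ∫ y in Ioo c d, χ y = 1 := by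
  let bump : ContDiffBump ((c + d) / 2) :=
    { rIn := (d - c) / 8, rOut := (d - c) / 4, rIn_pos := by linarith, rIn_lt_rOut := by linarith }
  have hχ : IsTestFunction (Ioo c d) (bump.normed volume) := by
    refine ⟨bump.contDiff_normed, bump.hasCompactSupport_normed, ?_⟩
    rw [bump.tsupport_normed_eq, Real.closedBall_eq_Icc]
    change Icc ((c + d) / 2 - (d - c) / 4) ((c + d) / 2 + (d - c) / 4) ⊆ Ioo c d
    exact Icc_subset_Ioo (by linarith) (by linarith)
  refine ⟨_, hχ, ?_⟩
  rw [setIntegral_eq_integral_of_forall_compl_eq_zero fun y hy => hχ.eq_zero hy,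
    bump.integral_normed]

lemma exists_Icc_superset_of_isCompact_subset_Ioo {c d : ℝ} (hcd : c < d) {K : Set ℝ}
    (hK : IsCompact K) (hKcd : K ⊆ Ioo c d) : ∃ a b, c < a ∧ b < d ∧ K ⊆ Icc a b := by
  rcases K.eq_empty_or_nonempty with rfl | hne
  · exact ⟨d, c, hcd, hcd, empty_subset _⟩
  · exact ⟨sInf K, sSup K, (hKcd (hK.sInf_mem hne)).1, (hKcd (hK.sSup_mem hne)).2,
      fun x hx => ⟨csInf_le hK.bddBelow hx, le_csSup hK.bddAbove hx⟩⟩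

lemma intervalIntegral_eq_zero_of_notMem_Icc {a b c d y : ℝ} {η : ℝ → ℝ} (hca : c < a)
    (hbd : b < d) (hη : ∀ t ∉ Icc a b, η t = 0)
    (hmean : ∫ t in Ioo c d, η t = 0) (hy : y ∉ Icc a b) : ∫ t in c..y, η t = 0 := by
  rcases lt_or_ge y a with hya | hay
  · refine intervalIntegral.integral_zero_ae (ae_of_all _ fun t ht => hη t fun h => ?_)
    rcases mem_uIoc.1 ht with ht | ht <;> linarith [h.1]
  · have hby : b < y := not_le.1 fun h => hy ⟨hay, h⟩
    have hIoc : ∀ t ∉ Ioc c y, η t = 0 := fun t ht =>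
      hη t fun h => ht ⟨by linarith [h.1], by linarith [h.2]⟩
    have hIoo : ∀ t ∉ Ioo c d, η t = 0 := fun t ht =>
      hη t fun h => ht ⟨by linarith [h.1], by linarith [h.2]⟩
    rw [← hmean, intervalIntegral.integral_of_le (by linarith),
      setIntegral_eq_integral_of_forall_compl_eq_zero hIoc,
      setIntegral_eq_integral_of_forall_compl_eq_zero hIoo]

lemma IsTestFunction.exists_deriv_eq {c d : ℝ} (hcd : c < d) {η : ℝ → ℝ}
    (hη : IsTestFunction (Ioo c d) η) (hmean : ∫ y in Ioo c d, η y = 0) :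
    ∃ β : ℝ → ℝ, IsTestFunction (Ioo c d) β ∧ deriv β = η := by
  obtain ⟨a, b, hca, hbd, hab⟩ := exists_Icc_superset_of_isCompact_subset_Ioo hcd hη.2.1 hη.2.2
  have hzero {y : ℝ} (hy : y ∉ Icc a b) : η y = 0 :=
    image_eq_zero_of_notMem_tsupport fun h => hy (hab h)
  have hderiv (y : ℝ) : HasDerivAt (fun y => ∫ t in c..y, η t) (η y) y :=
    intervalIntegral.integral_hasDerivAt_right (hη.1.continuous.intervalIntegrable _ _)
      (hη.1.continuous.stronglyMeasurableAtFilter _ _) hη.1.continuous.continuousAt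
  have hsupp {y : ℝ} (hy : y ∉ Icc a b) : ∫ t in c..y, η t = 0 :=
    intervalIntegral_eq_zero_of_notMem_Icc hca hbd (fun t => hzero) hmean hy
  have hd : deriv (fun y => ∫ t in c..y, η t) = η := funext fun y => (hderiv y).deriv
  refine ⟨_, ⟨?_, HasCompactSupport.intro isCompact_Icc fun y => hsupp, ?_⟩, hd⟩
  · rw [contDiff_infty_iff_deriv, hd]
    exact ⟨fun y => (hderiv y).differentiableAt, hη.1⟩
  · refine (closure_minimal (fun y hy => ?_) isClosed_Icc).trans (Icc_subset_Ioo hca hbd)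
    by_contra h
    exact hy (hsupp h)

lemma setIntegral_primitive_mul_deriv {c d : ℝ} (hcd : c < d) {g β : ℝ → ℝ}
    (hg : IntegrableOn g (Ioo c d)) (hβ : IsTestFunction (Ioo c d) β) :
    ∫ y in Ioo c d, (∫ s in c..y, g s) * deriv β y = -∫ y in Ioo c d, g y * β y := by
  have hgI : IntervalIntegrable g volume c d :=
    (intervalIntegrable_iff_integrableOn_Ioo_of_le hcd.le).2 hg
  have hac : AbsolutelyContinuousOnInterval β c d :=
    (hβ.1.of_le (by norm_cast)).contDiffOn.absolutelyContinuousOnInterval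
  have hparts := hac.integral_mul_deriv_eq_deriv_mul
    (hgI.absolutelyContinuousOnInterval_intervalIntegral (c := c) left_mem_uIcc)
  rw [hβ.eq_zero (x := c) (by simp), hβ.eq_zero (x := d) (by simp), zero_mul, zero_mul, sub_zero,
    zero_sub] at hparts
  have hderiv :
      ∫ y in c..d, β y * deriv (fun y => ∫ s in c..y, g s) y = ∫ y in c..d, g y * β y := by
    refine intervalIntegral.integral_congr_ae ?_
    filter_upwards [hgI.ae_hasDerivAt_integral] with y hy hy'
    rw [(hy (uIoc_subset_uIcc hy') c left_mem_uIcc).deriv, mul_comm]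
  simp only [hderiv, intervalIntegral.integral_of_le hcd.le, integral_Ioc_eq_integral_Ioo] at hparts
  simp only [hparts, neg_neg, mul_comm]

lemma setIntegral_sub_primitive_mul_deriv {c d : ℝ} (hcd : c < d) {v g β : ℝ → ℝ}
    (hv : IntegrableOn v (Ioo c d)) (hg : IntegrableOn g (Ioo c d))
    (hβ : IsTestFunction (Ioo c d) β)
    (h : ∫ y in Ioo c d, v y * deriv β y = -∫ y in Ioo c d, g y * β y) :
    ∫ y in Ioo c d, (v y - ∫ s in c..y, g s) * deriv β y = 0 := by
  have hgI : IntervalIntegrable g volume c d :=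
    (intervalIntegrable_iff_integrableOn_Ioo_of_le hcd.le).2 hg
  have hP : IntegrableOn (fun y => ∫ s in c..y, g s) (Ioo c d) := by
    refine IntegrableOn.mono_set ?_ Ioo_subset_Icc_self
    have := hgI.absolutelyContinuousOnInterval_intervalIntegral (c := c) left_mem_uIcc
    exact (uIcc_of_le hcd.le ▸ this.continuousOn).integrableOn_Icc
  simp only [sub_mul]
  rw [integral_sub (hβ.deriv.integrable_mul hv) (hβ.deriv.integrable_mul hP), h,
    setIntegral_primitive_mul_deriv hcd hg hβ, sub_self]

/-! ## Absolute continuity on lines -/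

section AbsoluteContinuity

variable {X Y : Type*} [MeasurableSpace X] [MeasurableSpace Y] {μ : Measure X} {ν : Measure Y}

lemma ae_eq_zero_of_forall_setIntegral_prod_eq_zero [SFinite μ] [SFinite ν] {W : X × Y → ℝ}
    (hW : Integrable W (μ.prod ν))
    (h : ∀ A B, MeasurableSet A → MeasurableSet B → ∫ z in A ×ˢ B, W z ∂μ.prod ν = 0) :
    W =ᵐ[μ.prod ν] 0 := by
  suffices ∀ s, MeasurableSet s → ∫ z in s, W z ∂μ.prod ν = 0 from
    hW.ae_eq_zero_of_forall_setIntegral_eq_zero fun s hs _ => this s hs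
  refine MeasurableSpace.induction_on_inter generateFrom_prod.symm isPiSystem_prod (by simp) ?_
    (fun t ht ih => ?_) fun f hdisj hmeas ih => ?_
  · rintro _ ⟨A, hA, B, hB, rfl⟩
    exact h A B hA hB
  · have htotal := h univ univ .univ .univ
    rw [univ_prod_univ, setIntegral_univ] at htotal
    rw [setIntegral_compl ht hW, htotal, ih, sub_zero]
  · rw [integral_iUnion hmeas hdisj hW.integrableOn]
    simp only [ih, tsum_zero]

section TestFunctions

variable {E : Type*} [NormedAddCommGroup E] [InnerProductSpace ℝ E] [FiniteDimensional ℝ E]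
  [MeasurableSpace E] [BorelSpace E] {ρ : Measure E} {U : Set E}

lemma ae_eq_zero_of_forall_integral_mul_isTestFunction {f : E → ℝ} (hU : IsOpen U)
    (hf : IntegrableOn f U ρ)
    (h : ∀ φ, IsTestFunction U φ → ∫ x in U, f x * φ x ∂ρ = 0) : f =ᵐ[ρ.restrict U] 0 := by
  rw [EventuallyEq, ae_restrict_iff' hU.measurableSet]
  refine hU.ae_eq_zero_of_integral_contDiff_smul_eq_zero hf.locallyIntegrableOn
    fun φ hφ hφc hφU => ?_
  have hzero (x : E) (hx : x ∉ U) : φ x • f x = 0 := by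
    rw [image_eq_zero_of_notMem_tsupport fun h => hx (hφU h), zero_smul]
  rw [← setIntegral_eq_integral_of_forall_compl_eq_zero hzero, ← h φ ⟨hφ, hφc, hφU⟩]
  simp only [smul_eq_mul, mul_comm]

lemma ae_prod_eq_zero_of_forall_ae_integral_mul_isTestFunction [SFinite μ] [SFinite ρ]
    {W : X × E → ℝ} (hU : IsOpen U) (hW : Integrable W (μ.prod (ρ.restrict U)))
    (h : ∀ φ, IsTestFunction U φ → ∀ᵐ x ∂μ, ∫ y in U, W (x, y) * φ y ∂ρ = 0) :
    W =ᵐ[μ.prod (ρ.restrict U)] 0 := by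
  refine ae_eq_zero_of_forall_setIntegral_prod_eq_zero hW fun A B _ _ => ?_
  have hWA : Integrable W ((μ.restrict A).prod (ρ.restrict U)) :=
    hW.mono_measure (Measure.prod_mono Measure.restrict_le_self le_rfl)
  have hslice : (fun y => ∫ x in A, W (x, y) ∂μ) =ᵐ[ρ.restrict U] 0 := by
    refine ae_eq_zero_of_forall_integral_mul_isTestFunction hU hWA.integral_prod_right
      fun φ hφ => ?_
    have hint := hφ.integrable_mul_comp hWA measurable_snd
    simp only [← integral_mul_const]
    rw [← integral_integral_swap hint, integral_congr_ae (ae_restrict_of_ae (h φ hφ)),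
      integral_zero]
  rw [← Measure.prod_restrict, integral_prod_symm _ (hWA.mono_measure ?_),
    integral_congr_ae (ae_restrict_of_ae hslice)]
  · simp
  · exact Measure.prod_mono le_rfl Measure.restrict_le_self

end TestFunctions

lemma integrable_prod_intervalIntegral [SFinite μ] {c d : ℝ} {G : X × ℝ → ℝ}
    (hG : Integrable G (μ.prod (volume.restrict (Ioo c d)))) :
    Integrable (fun z : X × ℝ => ∫ s in c..z.2, G (z.1, s))
      (μ.prod (volume.restrict (Ioo c d))) := by
  have hG3 := ((measurePreserving_prodAssoc (volume.restrict (Ioo c d)) μ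
    (volume.restrict (Ioo c d))).integrable_comp_emb
      MeasurableEquiv.prodAssoc.measurableEmbedding).2 (hG.comp_snd (volume.restrict (Ioo c d)))
  have hmeas : MeasurableSet {q : (ℝ × X) × ℝ | q.2 ≤ q.1.1} :=
    measurableSet_le measurable_snd (measurable_fst.comp measurable_fst)
  refine (hG3.indicator hmeas).integral_prod_left.swap.congr ?_
  have hmem : ∀ᵐ z : X × ℝ ∂μ.prod (volume.restrict (Ioo c d)), z.2 ∈ Ioo c d :=
    Measure.quasiMeasurePreserving_snd.ae (ae_restrict_mem measurableSet_Ioo)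
  filter_upwards [hmem] with z hz
  simp only [Function.comp_apply, Prod.swap, intervalIntegral.integral_of_le hz.1.le]
  rw [← integral_indicator measurableSet_Ioc, ← integral_indicator measurableSet_Ioo]
  refine integral_congr_ae (ae_of_all _ fun s => ?_)
  simp only [indicator, mem_Ioo, mem_Ioc, mem_ofPred_eq, Function.comp_apply] at hz ⊢
  change (if _ then (if _ then G (z.1, s) else 0) else 0) = _
  grind

section Primitive

variable {E : Type*} [NormedAddCommGroup E] [InnerProductSpace ℝ E] [FiniteDimensional ℝ E]
  [MeasurableSpace E] [BorelSpace E] {ρ : Measure E} [SFinite ρ] {U : Set E} {c d : ℝ}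
  {V G : E × ℝ → ℝ}

lemma ae_integral_mul_deriv_eq_neg (hU : IsOpen U)
    (hV : Integrable V ((ρ.restrict U).prod (volume.restrict (Ioo c d))))
    (hG : Integrable G ((ρ.restrict U).prod (volume.restrict (Ioo c d))))
    (h : ∀ α β, IsTestFunction U α → IsTestFunction (Ioo c d) β →
      ∫ z, V z * (α z.1 * deriv β z.2) ∂(ρ.restrict U).prod (volume.restrict (Ioo c d)) =
        -∫ z, G z * (α z.1 * β z.2) ∂(ρ.restrict U).prod (volume.restrict (Ioo c d)))
    {β : ℝ → ℝ} (hβ : IsTestFunction (Ioo c d) β) :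
    ∀ᵐ x ∂ρ.restrict U,
      ∫ y in Ioo c d, V (x, y) * deriv β y = -∫ y in Ioo c d, G (x, y) * β y := by
  have hVβ := hβ.deriv.integrable_mul_comp hV measurable_snd
  have hGβ := hβ.integrable_mul_comp hG measurable_snd
  have hzero := ae_eq_zero_of_forall_integral_mul_isTestFunction hU
    (hVβ.integral_prod_left.add hGβ.integral_prod_left) fun α hα => by
      have hα1 := hα.integrable_mul_comp hVβ measurable_fst
      have hα2 := hα.integrable_mul_comp hGβ measurable_fst
      have hαβ := h α β hα hβ
      simp only [mul_comm (α _), ← mul_assoc] at hαβ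
      rw [integral_prod _ hα1, integral_prod _ hα2] at hαβ
      simp only [Pi.add_apply, add_mul, ← integral_mul_const]
      rw [integral_add hα1.integral_prod_left hα2.integral_prod_left, hαβ, neg_add_cancel]
  filter_upwards [hzero] with x hx using eq_neg_of_add_eq_zero_left hx

/-- Testing with `β - (∫ β) χ`, where `∫ χ = 1`, whose primitive is a test function, shows that
`V - ∫ G` does not depend on the last variable. -/
lemma ae_exists_ae_eq_const_add_integral (hU : IsOpen U) (hcd : c < d)
    (hV : Integrable V ((ρ.restrict U).prod (volume.restrict (Ioo c d))))
    (hG : Integrable G ((ρ.restrict U).prod (volume.restrict (Ioo c d))))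
    (h : ∀ α β, IsTestFunction U α → IsTestFunction (Ioo c d) β →
      ∫ z, V z * (α z.1 * deriv β z.2) ∂(ρ.restrict U).prod (volume.restrict (Ioo c d)) =
        -∫ z, G z * (α z.1 * β z.2) ∂(ρ.restrict U).prod (volume.restrict (Ioo c d))) :
    ∀ᵐ x ∂ρ.restrict U, IntegrableOn (fun y => G (x, y)) (Ioo c d) ∧
      ∃ k, ∀ᵐ y ∂volume.restrict (Ioo c d), V (x, y) = k + ∫ s in c..y, G (x, s) := by
  obtain ⟨χ, hχ, hχ1⟩ := exists_isTestFunction_Ioo_integral_eq_one hcd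
  have hF := hV.sub (integrable_prod_intervalIntegral hG)
  set F : E × ℝ → ℝ := V - fun z => ∫ s in c..z.2, G (z.1, s) with hFdef
  have hk := (hχ.integrable_mul_comp hF measurable_snd).integral_prod_left
  set k : E → ℝ := fun x => ∫ y in Ioo c d, F (x, y) * χ y
  have hW := ae_prod_eq_zero_of_forall_ae_integral_mul_isTestFunction isOpen_Ioo
    (hF.sub (hk.comp_fst _)) fun β hβ => by
      set m := ∫ y in Ioo c d, β y with hm
      have hβint : IntegrableOn β (Ioo c d) := hβ.integrable.integrableOn
      have hχint : IntegrableOn χ (Ioo c d) := hχ.integrable.integrableOn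
      obtain ⟨η, hη, hη'⟩ := (hβ.sub (hχ.const_mul m)).exists_deriv_eq hcd (by
        rw [integral_sub hβint (hχint.const_mul m), integral_const_mul, hχ1, mul_one, sub_self])
      filter_upwards [ae_integral_mul_deriv_eq_neg hU hV hG h hη, hV.prod_right_ae,
        hG.prod_right_ae, hF.prod_right_ae] with x hx hVx hGx hFx
      have hFη := setIntegral_sub_primitive_mul_deriv hcd hVx hGx hη hx
      change ∫ y in Ioo c d, F (x, y) * deriv η y = 0 at hFη
      have hFβ := hβ.integrable_mul hFx
      simp only [hη', mul_sub, mul_left_comm _ m] at hFη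
      rw [integral_sub hFβ ((hχ.integrable_mul hFx).const_mul m), integral_const_mul] at hFη
      simp only [Pi.sub_apply, sub_mul]
      rw [integral_sub hFβ (hβint.const_mul (k x)), integral_const_mul, ← hm, mul_comm (k x)]
      exact hFη
  filter_upwards [hG.prod_right_ae, Measure.ae_ae_of_ae_prod hW] with x hGx hx
  refine ⟨hGx, k x, ?_⟩
  filter_upwards [hx] with y hy
  simp only [hFdef, Pi.sub_apply, Pi.zero_apply] at hy
  linarith

end Primitive

end AbsoluteContinuity

/-! ## Weak gradients on rectangles -/

/-- The identification of `ℝ × ℝ` with the Euclidean plane, which turns integrals over rectangles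
into iterated integrals. -/
def toPlane : ℝ × ℝ ≃ᵐ EuclideanSpace ℝ (Fin 2) :=
  MeasurableEquiv.finTwoArrow.symm.trans (MeasurableEquiv.toLp 2 (Fin 2 → ℝ))

@[simp] lemma toPlane_apply_zero (p : ℝ × ℝ) : toPlane p 0 = p.1 := rfl

@[simp] lemma toPlane_apply_one (p : ℝ × ℝ) : toPlane p 1 = p.2 := rfl

lemma toPlane_apply_coords (z : EuclideanSpace ℝ (Fin 2)) : toPlane (z 0, z 1) = z := by
  ext i; fin_cases i <;> rfl

lemma continuous_toPlane : Continuous toPlane := by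
  refine (PiLp.continuous_toLp 2 _).comp (continuous_pi fun i => ?_)
  fin_cases i
  exacts [continuous_fst, continuous_snd]

lemma measurePreserving_toPlane : MeasurePreserving toPlane volume volume :=
  (PiLp.volume_preserving_toLp (Fin 2)).comp ((volume_preserving_finTwoArrow ℝ).symm _)

section Tensor

variable {Ω : Set (EuclideanSpace ℝ (Fin 2))} {D I : Set ℝ} {α β : ℝ → ℝ}

lemma IsTestFunction.mul_coords (hΩ : D ×ˢ I ⊆ toPlane ⁻¹' Ω) (hα : IsTestFunction D α)
    (hβ : IsTestFunction I β) : IsTestFunction Ω (fun z => α (z 0) * β (z 1)) := by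
  have hK : IsCompact (toPlane '' (tsupport α ×ˢ tsupport β)) :=
    (hα.2.1.isCompact.prod hβ.2.1.isCompact).image continuous_toPlane
  have hsub : tsupport (fun z : EuclideanSpace ℝ (Fin 2) => α (z 0) * β (z 1)) ⊆
      toPlane '' (tsupport α ×ˢ tsupport β) := by
    refine closure_minimal (fun z hz => ⟨(z 0, z 1), ⟨?_, ?_⟩, toPlane_apply_coords z⟩) hK.isClosed
    · exact subset_tsupport _ (left_ne_zero_of_mul hz)
    · exact subset_tsupport _ (right_ne_zero_of_mul hz)
  refine ⟨(hα.1.comp (by fun_prop)).mul (hβ.1.comp (by fun_prop)),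
    hK.of_isClosed_subset (isClosed_tsupport _) hsub, hsub.trans (image_subset_iff.2 ?_)⟩
  exact (prod_mono hα.2.2 hβ.2.2).trans hΩ

lemma fderiv_mul_coords_apply (hα : Differentiable ℝ α) (hβ : Differentiable ℝ β)
    (z v : EuclideanSpace ℝ (Fin 2)) :
    fderiv ℝ (fun z : EuclideanSpace ℝ (Fin 2) => α (z 0) * β (z 1)) z v =
      deriv α (z 0) * β (z 1) * v 0 + α (z 0) * deriv β (z 1) * v 1 := by
  have hcoord (i : Fin 2) : HasFDerivAt (fun z : EuclideanSpace ℝ (Fin 2) => z i)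
      (EuclideanSpace.proj i : EuclideanSpace ℝ (Fin 2) →L[ℝ] ℝ) z :=
    (EuclideanSpace.proj i : EuclideanSpace ℝ (Fin 2) →L[ℝ] ℝ).hasFDerivAt
  have hmul := ((hα (z 0)).hasDerivAt.comp_hasFDerivAt z (hcoord 0)).mul
    ((hβ (z 1)).hasDerivAt.comp_hasFDerivAt z (hcoord 1))
  refine (congrArg (· v) hmul.fderiv).trans ?_
  simp
  ring

lemma setIntegral_eq_integral_prod (hΩ : D ×ˢ I ⊆ toPlane ⁻¹' Ω)
    {F : EuclideanSpace ℝ (Fin 2) → ℝ} (hF : ∀ z, z 0 ∉ D ∨ z 1 ∉ I → F z = 0) :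
    ∫ z in Ω, F z = ∫ p, F (toPlane p) ∂(volume.restrict D).prod (volume.restrict I) := by
  have hF' : ∀ p ∉ D ×ˢ I, F (toPlane p) = 0 := fun p hp => hF _ (not_and_or.1 hp)
  have hFΩ : ∀ z ∉ Ω, F z = 0 := fun z hz => by
    rw [← toPlane_apply_coords z] at hz ⊢
    exact hF' _ fun h => hz (hΩ h)
  rw [Measure.prod_restrict, ← Measure.volume_eq_prod,
    setIntegral_eq_integral_of_forall_compl_eq_zero hFΩ,
    setIntegral_eq_integral_of_forall_compl_eq_zero hF',
    measurePreserving_toPlane.integral_comp toPlane.measurableEmbedding]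

lemma IsWeakGradient.integral_mul_coords {u : EuclideanSpace ℝ (Fin 2) → ℝ}
    {g : EuclideanSpace ℝ (Fin 2) → EuclideanSpace ℝ (Fin 2)} (h : IsWeakGradient Ω u g)
    (hΩ : D ×ˢ I ⊆ toPlane ⁻¹' Ω) (hα : IsTestFunction D α) (hβ : IsTestFunction I β)
    (v : EuclideanSpace ℝ (Fin 2)) :
    ∫ z, u (toPlane z) * (deriv α z.1 * β z.2 * v 0 + α z.1 * deriv β z.2 * v 1)
        ∂(volume.restrict D).prod (volume.restrict I) =
      -∫ z, ⟪g (toPlane z), v⟫ * (α z.1 * β z.2)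
        ∂(volume.restrict D).prod (volume.restrict I) := by
  have key := h _ (hα.mul_coords hΩ hβ) v
  simp only [fderiv_mul_coords_apply (hα.1.differentiable (by simp))
    (hβ.1.differentiable (by simp))] at key
  rwa [setIntegral_eq_integral_prod hΩ, setIntegral_eq_integral_prod hΩ] at key
  · rintro z (hz | hz)
    · rw [hα.eq_zero hz]; ring
    · rw [hβ.eq_zero hz]; ring
  · rintro z (hz | hz)
    · rw [hα.eq_zero hz, hα.deriv.eq_zero hz]; ring
    · rw [hβ.eq_zero hz, hβ.deriv.eq_zero hz]; ring

end Tensor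

section Rectangle

variable {Ω : Set (EuclideanSpace ℝ (Fin 2))} {u : EuclideanSpace ℝ (Fin 2) → ℝ}
  {g : EuclideanSpace ℝ (Fin 2) → EuclideanSpace ℝ (Fin 2)} {D : Set ℝ} {c d : ℝ}

lemma IsWeakGradient.ae_vertical_primitive (h : IsWeakGradient Ω u g)
    (hD : IsOpen D) (hcd : c < d) (hΩ : D ×ˢ Ioo c d ⊆ toPlane ⁻¹' Ω)
    (hu : IntegrableOn (fun p => u (toPlane p)) (D ×ˢ Ioo c d))
    (hg : IntegrableOn (fun p => g (toPlane p) 1) (D ×ˢ Ioo c d)) :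
    ∀ᵐ x ∂volume.restrict D, IntegrableOn (fun y => g (toPlane (x, y)) 1) (Ioo c d) ∧
      ∃ k : ℝ, ∀ᵐ y ∂volume.restrict (Ioo c d),
        u (toPlane (x, y)) = k + ∫ s in c..y, g (toPlane (x, s)) 1 := by
  rw [IntegrableOn, Measure.volume_eq_prod, ← Measure.prod_restrict] at hu hg
  refine ae_exists_ae_eq_const_add_integral hD hcd hu hg fun α β hα hβ => ?_
  simpa [EuclideanSpace.inner_single_right] using
    h.integral_mul_coords hΩ hα hβ (EuclideanSpace.single 1 1)

lemma IsWeakGradient.ae_horizontal_primitive (h : IsWeakGradient Ω u g)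
    (hD : IsOpen D) (hcd : c < d) (hΩ : Ioo c d ×ˢ D ⊆ toPlane ⁻¹' Ω)
    (hu : IntegrableOn (fun p => u (toPlane p)) (Ioo c d ×ˢ D))
    (hg : IntegrableOn (fun p => g (toPlane p) 0) (Ioo c d ×ˢ D)) :
    ∀ᵐ y ∂volume.restrict D, IntegrableOn (fun x => g (toPlane (x, y)) 0) (Ioo c d) ∧
      ∃ k : ℝ, ∀ᵐ x ∂volume.restrict (Ioo c d),
        u (toPlane (x, y)) = k + ∫ s in c..x, g (toPlane (s, y)) 0 := by
  rw [IntegrableOn, Measure.volume_eq_prod, ← Measure.prod_restrict] at hu hg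
  refine ae_exists_ae_eq_const_add_integral hD hcd (V := fun p => u (toPlane p.swap))
    (G := fun p => g (toPlane p.swap) 0) hu.swap hg.swap fun α β hα hβ => ?_
  have key := h.integral_mul_coords hΩ hβ hα (EuclideanSpace.single 0 1)
  rw [← integral_prod_swap, ← integral_prod_swap (fun z => ⟪g (toPlane z), _⟫ * _)] at key
  simpa [EuclideanSpace.inner_single_right, mul_comm (α _)] using key

end Rectangle

/-! ## The components of an element of `H¹` -/

section H1

variable {d : ℕ} {Ω : Set (EuclideanSpace ℝ (Fin d))}

/-- A representative of the gradient of `u ∈ H¹(Ω)`; as for `h1Rep`, only its values almost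
everywhere in `Ω` are meaningful. -/
def h1Grad (u : H1 Ω) : EuclideanSpace ℝ (Fin d) → EuclideanSpace ℝ (Fin d) :=
  u.1.snd

lemma memLp_h1Rep (u : H1 Ω) : MemLp (h1Rep u) 2 (volume.restrict Ω) := Lp.memLp u.1.fst

lemma memLp_h1Grad (u : H1 Ω) : MemLp (h1Grad u) 2 (volume.restrict Ω) := Lp.memLp u.1.snd

lemma memLp_h1Grad_apply (u : H1 Ω) (i : Fin d) :
    MemLp (fun z => h1Grad u z i) 2 (volume.restrict Ω) :=
  (memLp_h1Grad u).continuousLinearMap_comp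
    (EuclideanSpace.proj i : EuclideanSpace ℝ (Fin d) →L[ℝ] ℝ)

lemma isWeakGradient_h1Grad (u : H1 Ω) : IsWeakGradient Ω (h1Rep u) (h1Grad u) := u.2

lemma norm_snd_le_norm (u : H1 Ω) : ‖u.1.snd‖ ≤ ‖u‖ := by
  have h := WithLp.prod_norm_sq_eq_of_L2 u.1
  rw [Submodule.coe_norm]
  exact le_of_sq_le_sq (h ▸ le_add_of_nonneg_left (sq_nonneg _)) (norm_nonneg _)

lemma eLpNorm_h1Grad_le (u : H1 Ω) :
    eLpNorm (h1Grad u) 2 (volume.restrict Ω) ≤ ENNReal.ofReal ‖u‖ := by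
  rw [← ENNReal.ofReal_toReal (memLp_h1Grad u).eLpNorm_ne_top]
  exact ENNReal.ofReal_le_ofReal ((Lp.norm_def u.1.snd).symm.trans_le (norm_snd_le_norm u))

end H1

lemma integral_abs_le_sqrt_mul_toReal_eLpNorm {X : Type*} [MeasurableSpace X] {μ : Measure X}
    [IsFiniteMeasure μ] {f : X → ℝ} (hf : MemLp f 2 μ) :
    ∫ x, |f x| ∂μ ≤ √(μ.real univ) * (eLpNorm f 2 μ).toReal := by
  have hle := eLpNorm_le_eLpNorm_mul_rpow_measure_univ (p := 1) (q := 2) (by norm_num)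
    hf.aestronglyMeasurable
  have htop : eLpNorm f 2 μ * μ univ ^ (1 / (1 : ENNReal).toReal - 1 / (2 : ENNReal).toReal) ≠ ⊤ :=
    ENNReal.mul_ne_top hf.eLpNorm_ne_top
      (ENNReal.rpow_ne_top_of_nonneg (by norm_num) (measure_ne_top μ _))
  have hnorm : ∫ x, |f x| ∂μ = (eLpNorm f 1 μ).toReal := by
    rw [eLpNorm_one_eq_lintegral_enorm, ← integral_norm_eq_lintegral_enorm hf.aestronglyMeasurable]
    rfl
  rw [hnorm, Real.sqrt_eq_rpow, mul_comm]
  refine (ENNReal.toReal_mono htop hle).trans_eq ?_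
  rw [ENNReal.toReal_mul, ← ENNReal.toReal_rpow]
  norm_num [Measure.real]

section Restrict

variable {Ω : Set (EuclideanSpace ℝ (Fin 2))} {R : Set (ℝ × ℝ)}

lemma measurePreserving_toPlane_restrict :
    MeasurePreserving toPlane (volume.restrict (toPlane ⁻¹' Ω)) (volume.restrict Ω) :=
  measurePreserving_toPlane.restrict_preimage_emb toPlane.measurableEmbedding Ω

lemma memLp_comp_toPlane {f : EuclideanSpace ℝ (Fin 2) → ℝ} (hf : MemLp f 2 (volume.restrict Ω))
    (hR : R ⊆ toPlane ⁻¹' Ω) : MemLp (fun p => f (toPlane p)) 2 (volume.restrict R) :=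
  (hf.comp_measurePreserving measurePreserving_toPlane_restrict).mono_measure
    (Measure.restrict_mono hR le_rfl)

lemma integrableOn_comp_toPlane {f : EuclideanSpace ℝ (Fin 2) → ℝ}
    (hf : MemLp f 2 (volume.restrict Ω)) (hR : R ⊆ toPlane ⁻¹' Ω) (hRf : volume R ≠ ⊤) :
    IntegrableOn (fun p => f (toPlane p)) R :=
  have : IsFiniteMeasure (volume.restrict R) := ⟨by simpa using hRf.lt_top⟩
  (memLp_comp_toPlane hf hR).integrable (by norm_num)

lemma setIntegral_abs_h1Grad_le (u : H1 Ω) (i : Fin 2) (hR : R ⊆ toPlane ⁻¹' Ω)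
    (hRf : volume R ≠ ⊤) :
    ∫ p in R, |h1Grad u (toPlane p) i| ≤ √(volume.real R) * ‖u‖ := by
  have : IsFiniteMeasure (volume.restrict R) := ⟨by simpa using hRf.lt_top⟩
  have hle : eLpNorm (fun p => h1Grad u (toPlane p) i) 2 (volume.restrict R) ≤
      ENNReal.ofReal ‖u‖ :=
    calc eLpNorm (fun p => h1Grad u (toPlane p) i) 2 (volume.restrict R)
        ≤ eLpNorm (fun p => h1Grad u (toPlane p)) 2 (volume.restrict R) :=
          eLpNorm_mono fun p => PiLp.norm_apply_le _ _
      _ ≤ eLpNorm (fun p => h1Grad u (toPlane p)) 2 (volume.restrict (toPlane ⁻¹' Ω)) :=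
          eLpNorm_mono_measure _ (Measure.restrict_mono hR le_rfl)
      _ = eLpNorm (h1Grad u) 2 (volume.restrict Ω) :=
          eLpNorm_comp_measurePreserving (memLp_h1Grad u).aestronglyMeasurable
            measurePreserving_toPlane_restrict
      _ ≤ _ := eLpNorm_h1Grad_le u
  refine (integral_abs_le_sqrt_mul_toReal_eLpNorm
    (memLp_comp_toPlane (memLp_h1Grad_apply u i) hR)).trans ?_
  rw [measureReal_restrict_apply_univ]
  exact mul_le_mul_of_nonneg_left (ENNReal.toReal_le_of_le_ofReal (norm_nonneg u) hle)
    (Real.sqrt_nonneg _)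

end Restrict

/-! ## Traces on horizontal lines -/

/-- The value at `a` of the primitive of `g` that coincides with `f` on `(a, b)`, expressed by
integrals so that it depends linearly on `f` and `g`; see `leftEndpointValue_eq`. -/
def leftEndpointValue (a b : ℝ) (f g : ℝ → ℝ) : ℝ :=
  (b - a)⁻¹ * ∫ y in Ioo a b, (f y - (b - y) * g y)

lemma intervalIntegral_primitive_eq {a b : ℝ} {g : ℝ → ℝ} (hg : IntervalIntegrable g volume a b) :
    ∫ y in a..b, (∫ s in a..y, g s) = ∫ y in a..b, (b - y) * g y := by
  have hw : AbsolutelyContinuousOnInterval (fun y : ℝ => b - y) a b :=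
    ContDiffOn.absolutelyContinuousOnInterval (by fun_prop)
  have hparts := hw.integral_mul_deriv_eq_deriv_mul
    (hg.absolutelyContinuousOnInterval_intervalIntegral (c := a) left_mem_uIcc)
  have hderiv : ∫ y in a..b, (b - y) * deriv (fun y => ∫ s in a..y, g s) y =
      ∫ y in a..b, (b - y) * g y := by
    refine intervalIntegral.integral_congr_ae ?_
    filter_upwards [hg.ae_hasDerivAt_integral] with y hy hy'
    rw [(hy (uIoc_subset_uIcc hy') a left_mem_uIcc).deriv]
  simpa [hderiv] using hparts.symm

lemma leftEndpointValue_eq {a b k : ℝ} (hab : a < b) {f g : ℝ → ℝ} (hg : IntegrableOn g (Ioo a b))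
    (h : ∀ᵐ y ∂volume.restrict (Ioo a b), f y = k + ∫ s in a..y, g s) :
    leftEndpointValue a b f g = k := by
  have hgI : IntervalIntegrable g volume a b :=
    (intervalIntegrable_iff_integrableOn_Ioo_of_le hab.le).2 hg
  have hP : IntervalIntegrable (fun y => ∫ s in a..y, g s) volume a b :=
    (hgI.absolutelyContinuousOnInterval_intervalIntegral
      left_mem_uIcc).continuousOn.intervalIntegrable
  have hcongr : ∫ y in Ioo a b, (f y - (b - y) * g y) =
      ∫ y in a..b, (k + (∫ s in a..y, g s) - (b - y) * g y) := by
    rw [intervalIntegral.integral_of_le hab.le, integral_Ioc_eq_integral_Ioo]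
    exact integral_congr_ae (h.mono fun y hy => by simp only [hy])
  rw [leftEndpointValue, hcongr, intervalIntegral.integral_sub
    (intervalIntegrable_const.add hP) (hgI.continuousOn_mul (by fun_prop)),
    intervalIntegral.integral_add intervalIntegrable_const hP, intervalIntegral_primitive_eq hgI,
    add_sub_cancel_right, intervalIntegral.integral_const, smul_eq_mul,
    inv_mul_cancel_left₀ (sub_ne_zero.2 hab.ne')]

lemma tendsto_leftEndpointValue {s c d k : ℝ} (hsc : s < c) (hcd : c < d) {f g : ℝ → ℝ}
    (hg : IntegrableOn g (Ioo s d))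
    (h : ∀ᵐ y ∂volume.restrict (Ioo s d), f y = k + ∫ t in s..y, g t) :
    Tendsto f (𝓝 c ⊓ ae volume) (𝓝 (leftEndpointValue c d f g)) := by
  have hsd := hsc.trans hcd
  have hgI {y : ℝ} (hy : y ∈ Icc s d) : IntervalIntegrable g volume s y :=
    (intervalIntegrable_iff_integrableOn_Ioo_of_le hy.1).2
      (hg.mono_set (Ioo_subset_Ioo_right hy.2))
  have hcont : ContinuousAt (fun y => k + ∫ t in s..y, g t) c := by
    refine continuousAt_const.add (((hgI ⟨hsd.le, le_rfl⟩)
      |>.absolutelyContinuousOnInterval_intervalIntegral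
        left_mem_uIcc).continuousOn.continuousAt ?_)
    exact uIcc_of_le hsd.le ▸ Icc_mem_nhds hsc hcd
  have hval : leftEndpointValue c d f g = k + ∫ t in s..c, g t := by
    refine leftEndpointValue_eq hcd (hg.mono_set (Ioo_subset_Ioo_left hsc.le)) ?_
    filter_upwards [ae_restrict_of_ae_restrict_of_subset (Ioo_subset_Ioo_left hsc.le) h,
      ae_restrict_mem measurableSet_Ioo] with y hy hyc
    have hc := hgI ⟨hsc.le, hcd.le⟩
    rw [hy, add_assoc, intervalIntegral.integral_add_adjacent_intervals hc
      (hc.symm.trans (hgI ⟨(hsc.trans hyc.1).le, hyc.2.le⟩))]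
  rw [hval]
  refine (hcont.tendsto.mono_left inf_le_left).congr' ?_
  rw [ae_restrict_iff' measurableSet_Ioo] at h
  filter_upwards [mem_inf_of_left (Ioo_mem_nhds hsc hcd), mem_inf_of_right h] with y hy hy'
  exact (hy' hy).symm

section HorizontalTrace

variable {Ω : Set (EuclideanSpace ℝ (Fin 2))} {D : Set ℝ} {s c d : ℝ}

/-- The trace of `v ∈ H¹(Ω)` on the line of height `c`, computed from the values of `v` and `∇v` at
the heights between `c` and `d`. -/
def horizontalTrace (v : H1 Ω) (c d x : ℝ) : ℝ :=
  leftEndpointValue c d (fun y => h1Rep v (toPlane (x, y))) (fun y => h1Grad v (toPlane (x, y)) 1)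

lemma volume_prod_Ioo_ne_top (hDf : volume D ≠ ⊤) : volume (D ×ˢ Ioo c d) ≠ ⊤ := by
  rw [Measure.volume_eq_prod, Measure.prod_prod]
  exact ENNReal.mul_ne_top hDf (by simp)

lemma ae_vertical_primitive_h1 (v : H1 Ω) (hD : IsOpen D) (hDf : volume D ≠ ⊤) (hcd : c < d)
    (hΩ : D ×ˢ Ioo c d ⊆ toPlane ⁻¹' Ω) :
    ∀ᵐ x ∂volume.restrict D, IntegrableOn (fun y => h1Grad v (toPlane (x, y)) 1) (Ioo c d) ∧
      ∃ k : ℝ, ∀ᵐ y ∂volume.restrict (Ioo c d),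
        h1Rep v (toPlane (x, y)) = k + ∫ s in c..y, h1Grad v (toPlane (x, s)) 1 :=
  (isWeakGradient_h1Grad v).ae_vertical_primitive hD hcd hΩ
    (integrableOn_comp_toPlane (memLp_h1Rep v) hΩ (volume_prod_Ioo_ne_top hDf))
    (integrableOn_comp_toPlane (memLp_h1Grad_apply v 1) hΩ (volume_prod_Ioo_ne_top hDf))

lemma ae_eq_horizontalTrace_add_integral (v : H1 Ω) (hD : IsOpen D) (hDf : volume D ≠ ⊤)
    (hcd : c < d) (hΩ : D ×ˢ Ioo c d ⊆ toPlane ⁻¹' Ω) :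
    ∀ᵐ x ∂volume.restrict D, ∀ᵐ y ∂volume.restrict (Ioo c d), h1Rep v (toPlane (x, y)) =
      horizontalTrace v c d x + ∫ s in c..y, h1Grad v (toPlane (x, s)) 1 := by
  filter_upwards [ae_vertical_primitive_h1 v hD hDf hcd hΩ] with x ⟨hg, k, hk⟩
  rwa [horizontalTrace, leftEndpointValue_eq hcd hg hk]

lemma isHorizontalTrace_horizontalTrace (v : H1 Ω) (hD : IsOpen D) (hDf : volume D ≠ ⊤)
    (hsc : s < c) (hcd : c < d) (hΩ : D ×ˢ Ioo s d ⊆ toPlane ⁻¹' Ω) :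
    IsHorizontalTrace (h1Rep v) c D (horizontalTrace v c d) := by
  filter_upwards [ae_vertical_primitive_h1 v hD hDf (hsc.trans hcd) hΩ] with x ⟨hg, k, hk⟩
  exact tendsto_leftEndpointValue hsc hcd hg hk

lemma integrable_sub_mul_h1Grad (v : H1 Ω) (hDf : volume D ≠ ⊤)
    (hΩ : D ×ˢ Ioo c d ⊆ toPlane ⁻¹' Ω) :
    Integrable (fun p : ℝ × ℝ => h1Rep v (toPlane p) - (d - p.2) * h1Grad v (toPlane p) 1)
      ((volume.restrict D).prod (volume.restrict (Ioo c d))) := by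
  have hu := integrableOn_comp_toPlane (memLp_h1Rep v) hΩ (volume_prod_Ioo_ne_top hDf)
  have hg := integrableOn_comp_toPlane (memLp_h1Grad_apply v 1) hΩ (volume_prod_Ioo_ne_top hDf)
  rw [IntegrableOn, Measure.volume_eq_prod, ← Measure.prod_restrict] at hu hg
  refine hu.sub (hg.bdd_mul (c := d - c) (by fun_prop) ?_)
  have hmem : ∀ᵐ p : ℝ × ℝ ∂(volume.restrict D).prod (volume.restrict (Ioo c d)), p.2 ∈ Ioo c d :=
    Measure.quasiMeasurePreserving_snd.ae (ae_restrict_mem measurableSet_Ioo)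
  filter_upwards [hmem] with p hp
  rw [Real.norm_eq_abs, abs_of_pos (sub_pos.2 hp.2)]
  exact sub_le_sub_left hp.1.le d

lemma integrableOn_horizontalTrace (v : H1 Ω) (hDf : volume D ≠ ⊤)
    (hΩ : D ×ˢ Ioo c d ⊆ toPlane ⁻¹' Ω) : IntegrableOn (horizontalTrace v c d) D :=
  (integrable_sub_mul_h1Grad v hDf hΩ).integral_prod_left.const_mul _

end HorizontalTrace

/-! ## Averages of traces as linear forms -/

section LinearForm

variable {d : ℕ} {Ω : Set (EuclideanSpace ℝ (Fin d))} {a : EuclideanSpace ℝ (Fin d) → ℝ}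
  {b : EuclideanSpace ℝ (Fin d) → EuclideanSpace ℝ (Fin d)}

/-- The linear form `v ↦ ∫_Ω (a v + b · ∇v)` on `H¹(Ω)`, as the inner product with `(a, b)`. -/
def h1Form (ha : MemLp a 2 (volume.restrict Ω)) (hb : MemLp b 2 (volume.restrict Ω)) :
    H1 Ω →L[ℝ] ℝ :=
  (innerSL ℝ (WithLp.toLp 2 (ha.toLp a, hb.toLp b))).comp (H1 Ω).subtypeL

lemma h1Form_apply (ha : MemLp a 2 (volume.restrict Ω)) (hb : MemLp b 2 (volume.restrict Ω))
    (v : H1 Ω) : h1Form ha hb v = ∫ z in Ω, (a z * h1Rep v z + ⟪b z, h1Grad v z⟫) := by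
  refine (WithLp.prod_inner_apply _ _).trans
    ((integral_add (L2.integrable_inner (𝕜 := ℝ) (ha.toLp a) v.1.fst)
      (L2.integrable_inner (𝕜 := ℝ) (hb.toLp b) v.1.snd)).symm.trans (integral_congr_ae ?_))
  filter_upwards [ha.coeFn_toLp, hb.coeFn_toLp] with z hza hzb
  simp only [hza, hzb, h1Rep, h1Grad, RCLike.inner_apply, conj_trivial, mul_comm]

end LinearForm

section AverageForm

variable {Ω : Set (EuclideanSpace ℝ (Fin 2))} {D : Set ℝ} {c d : ℝ}

lemma memLp_indicator_prod_Ioo (hD : MeasurableSet D) (hDf : volume D ≠ ⊤) {w : ℝ → ℝ}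
    (hw : Continuous w) : MemLp ((D ×ˢ Ioo c d).indicator fun p => w p.2) 2 volume := by
  have hR := hD.prod (measurableSet_Ioo (a := c) (b := d))
  have : IsFiniteMeasure (volume.restrict (D ×ˢ Ioo c d)) :=
    ⟨by simpa using (volume_prod_Ioo_ne_top hDf).lt_top⟩
  obtain ⟨C, hC⟩ := isCompact_Icc.exists_bound_of_continuousOn (hw.continuousOn (s := Icc c d))
  rw [memLp_indicator_iff_restrict hR]
  refine MemLp.of_bound (hw.comp continuous_snd).aestronglyMeasurable C ?_
  filter_upwards [ae_restrict_mem hR] with p hp using hC _ (Ioo_subset_Icc_self hp.2)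

lemma memLp_indicator_prod_Ioo_symm (hD : MeasurableSet D) (hDf : volume D ≠ ⊤) {w : ℝ → ℝ}
    (hw : Continuous w) :
    MemLp (fun z => (D ×ˢ Ioo c d).indicator (fun p => w p.2) (toPlane.symm z)) 2
      (volume.restrict Ω) :=
  ((memLp_indicator_prod_Ioo hD hDf hw).comp_measurePreserving
    (measurePreserving_toPlane.symm toPlane)).restrict Ω

/-- The linear form that maps `v ∈ H¹(Ω)` to the average over `D` of its trace at the height `c`,
with the trace computed on `D × (c, d)`; see `averageForm_apply`. -/
def averageForm (Ω : Set (EuclideanSpace ℝ (Fin 2))) (hD : MeasurableSet D) (hDf : volume D ≠ ⊤)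
    (c d : ℝ) : H1 Ω →L[ℝ] ℝ :=
  ((volume.real D)⁻¹ * (d - c)⁻¹) •
    h1Form (Ω := Ω) (memLp_indicator_prod_Ioo_symm (c := c) (d := d) hD hDf
        (w := fun _ => 1) continuous_const)
      ((memLp_indicator_prod_Ioo_symm (c := c) (d := d) hD hDf
        (w := fun y => y - d) (by fun_prop)).continuousLinearMap_comp
          (ContinuousLinearMap.toSpanSingleton ℝ (EuclideanSpace.single (1 : Fin 2) (1 : ℝ))))

lemma averageForm_apply (hD : MeasurableSet D) (hDf : volume D ≠ ⊤)
    (hΩ : D ×ˢ Ioo c d ⊆ toPlane ⁻¹' Ω) (v : H1 Ω) :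
    averageForm Ω hD hDf c d v = (volume.real D)⁻¹ * ∫ x in D, horizontalTrace v c d x := by
  simp only [horizontalTrace, leftEndpointValue, integral_const_mul]
  rw [averageForm, smul_apply, h1Form_apply, smul_eq_mul, mul_assoc,
    setIntegral_eq_integral_prod hΩ]
  · rw [← integral_prod _ (integrable_sub_mul_h1Grad v hDf hΩ), Measure.prod_restrict]
    congr 2
    refine setIntegral_congr_fun (hD.prod measurableSet_Ioo) fun p hp => ?_
    simp [hp, real_inner_smul_left, EuclideanSpace.inner_single_left]
    ring
  · intro z hz
    have hz' : toPlane.symm z ∉ D ×ˢ Ioo c d := fun h => hz.elim (· h.1) (· h.2)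
    simp [hz']

lemma isHorizontalAverage_averageForm (hD : MeasurableSet D) (hDf : volume D ≠ ⊤)
    (hΩ : D ×ˢ Ioo c d ⊆ toPlane ⁻¹' Ω)
    (h : ∀ v : H1 Ω, IsHorizontalTrace (h1Rep v) c D (horizontalTrace v c d)) :
    IsHorizontalAverage Ω c D (averageForm Ω hD hDf c d) := fun v =>
  ⟨_, h v, integrableOn_horizontalTrace v hDf hΩ, averageForm_apply hD hDf hΩ v⟩

end AverageForm

lemma thickening_prod_Ioo_subset {s : ℝ} (hs : 0 ≤ s) :
    Metric.thickening s cantorSet ×ˢ Ioo s 1 ⊆ toPlane ⁻¹' biconeDomain := by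
  rintro ⟨x, y⟩ ⟨hx, hy⟩
  have hy0 : 0 < y := hs.trans_lt hy.1
  refine mem_biconeDomain_iff.2 ?_
  simp only [toPlane_apply_zero, toPlane_apply_one, abs_of_pos hy0]
  exact ⟨hy0, hy.2, Metric.thickening_mono hy.1.le _ hx⟩

lemma lineDomain_prod_Ioo_subset (n : ℕ) :
    lineDomain n ×ˢ Ioo (lineHeight n) 1 ⊆ toPlane ⁻¹' biconeDomain := by
  rw [lineDomain_eq_thickening]
  exact thickening_prod_Ioo_subset (lineHeight_pos n).le

lemma isHorizontalTrace_thickening (v : H1 biconeDomain) {c : ℝ} (hc0 : 0 < c) (hc1 : c < 1) :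
    IsHorizontalTrace (h1Rep v) c (Metric.thickening c cantorSet) (horizontalTrace v c 1) := by
  obtain ⟨s, -, hs, hlim⟩ := exists_seq_strictMono_tendsto' hc0
  have hcover : Metric.thickening c cantorSet ⊆ ⋃ m, Metric.thickening (s m) cantorSet :=
    fun x hx => by
      obtain ⟨a, ha, hxa⟩ := Metric.mem_thickening_iff.1 hx
      obtain ⟨m, hm⟩ := (hlim.eventually (lt_mem_nhds hxa)).exists
      exact mem_iUnion.2 ⟨m, Metric.mem_thickening_iff.2 ⟨a, ha, hm⟩⟩
  refine ae_restrict_of_ae_restrict_of_subset hcover ((ae_restrict_iUnion_iff _ _).2 fun m => ?_)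
  exact isHorizontalTrace_horizontalTrace v Metric.isOpen_thickening
    (measure_ne_top_of_subset (thickening_cantorSet_subset _) (by simp)) (hs m).2 hc1
    (thickening_prod_Ioo_subset (hs m).1.le)

/-- The linear form `ν_n : v ↦ |D_n|⁻¹ ∫_{D_n} v(x, y_n) dx`. -/
def lineForm (n : ℕ) : H1 biconeDomain →L[ℝ] ℝ :=
  averageForm biconeDomain (measurableSet_lineDomain n) (volume_lineDomain_ne_top n)
    (lineHeight n) 1

lemma isHorizontalAverage_lineForm (n : ℕ) :
    IsHorizontalAverage biconeDomain (lineHeight n) (lineDomain n) (lineForm n) :=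
  isHorizontalAverage_averageForm _ _ (lineDomain_prod_Ioo_subset n) fun v =>
    lineDomain_eq_thickening n ▸ isHorizontalTrace_thickening v (lineHeight_pos n)
      ((lineHeight_le n).trans_lt (by norm_num))

/-! ## Convergence of the averages -/

lemma abs_sub_setAverage_le {α : Type*} [MeasurableSpace α] {μ : Measure α} {s : Set α}
    {f : α → ℝ} {k C : ℝ} (hs : μ s ≠ 0) (hs' : μ s ≠ ⊤) (hf : IntegrableOn f s μ)
    (h : ∀ᵐ x ∂μ.restrict s, |k - f x| ≤ C) : |k - ⨍ x in s, f x ∂μ| ≤ C := by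
  simp only [← Real.norm_eq_abs, ← mem_closedBall_iff_norm'] at h ⊢
  exact (convex_closedBall k C).set_average_mem Metric.isClosed_closedBall hs hs' h hf

section SetAverageProd

variable {A B : Set ℝ} {f : ℝ × ℝ → ℝ}

lemma integrableOn_prod_iff :
    IntegrableOn f (A ×ˢ B) ↔ Integrable f ((volume.restrict A).prod (volume.restrict B)) := by
  rw [IntegrableOn, Measure.volume_eq_prod, ← Measure.prod_restrict]

lemma abs_setAverage_le (A : Set ℝ) (f : ℝ → ℝ) :
    |⨍ x in A, f x| ≤ (volume.real A)⁻¹ * ∫ x in A, |f x| := by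
  rw [setAverage_eq, smul_eq_mul, abs_mul, abs_of_nonneg (by positivity)]
  gcongr
  exact abs_integral_le_integral_abs

lemma setAverage_sub {f g : ℝ → ℝ} (hf : IntegrableOn f A) (hg : IntegrableOn g A) :
    ⨍ x in A, (f x - g x) = (⨍ x in A, f x) - ⨍ x in A, g x := by
  rw [setAverage_eq, setAverage_eq, setAverage_eq, integral_sub hf hg, smul_sub]

lemma setAverage_prod (hf : IntegrableOn f (A ×ˢ B)) :
    ⨍ p in A ×ˢ B, f p = ⨍ x in A, ⨍ y in B, f (x, y) := by
  simp only [setAverage_eq, integral_smul, smul_smul]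
  rw [Measure.volume_eq_prod, measureReal_prod_prod, setIntegral_prod _ hf, mul_inv]

lemma setAverage_prod_symm (hf : IntegrableOn f (A ×ˢ B)) :
    ⨍ p in A ×ˢ B, f p = ⨍ y in B, ⨍ x in A, f (x, y) := by
  simp only [setAverage_eq, integral_smul, smul_smul]
  rw [Measure.volume_eq_prod, measureReal_prod_prod, ← Measure.prod_restrict,
    integral_prod_symm _ (integrableOn_prod_iff.1 hf), mul_inv_rev]

lemma integrableOn_setAverage_right (hf : IntegrableOn f (A ×ˢ B)) :
    IntegrableOn (fun x => ⨍ y in B, f (x, y)) A := by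
  simp only [setAverage_eq]
  exact Integrable.const_mul (integrableOn_prod_iff.1 hf).integral_prod_left _

lemma integrableOn_setAverage_left (hf : IntegrableOn f (A ×ˢ B)) :
    IntegrableOn (fun y => ⨍ x in A, f (x, y)) B := by
  simp only [setAverage_eq]
  exact Integrable.const_mul (integrableOn_prod_iff.1 hf).integral_prod_right _

end SetAverageProd

lemma volume_real_prod_Ioo {D : Set ℝ} {c d : ℝ} (hcd : c ≤ d) :
    volume.real (D ×ˢ Ioo c d) = volume.real D * (d - c) := by
  rw [Measure.volume_eq_prod, measureReal_prod_prod, Real.volume_real_Ioo_of_le hcd]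

lemma inv_mul_sqrt_mul {a : ℝ} (ha : 0 ≤ a) (b : ℝ) : a⁻¹ * √(a * b) = √(b / a) := by
  rw [Real.sqrt_mul ha, Real.sqrt_div' _ ha, ← mul_assoc, inv_mul_eq_div, Real.sqrt_div_self',
    one_div_mul_eq_div]

section Vertical

variable {Ω : Set (EuclideanSpace ℝ (Fin 2))} {D : Set ℝ} {s c d e : ℝ}

lemma ae_abs_horizontalTrace_sub_setAverage_le (v : H1 Ω) (hD : IsOpen D) (hDf : volume D ≠ ⊤)
    (hsc : s ≤ c) (hcd : c < d) (hde : d ≤ e) (hΩ : D ×ˢ Ioo s e ⊆ toPlane ⁻¹' Ω) :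
    ∀ᵐ x ∂volume.restrict D, |horizontalTrace v s e x - ⨍ y in Ioo c d, h1Rep v (toPlane (x, y))| ≤
      ∫ y in Ioo s d, |h1Grad v (toPlane (x, y)) 1| := by
  have hse : s < e := (hsc.trans_lt hcd).trans_le hde
  have hu := integrableOn_comp_toPlane (memLp_h1Rep v) hΩ (volume_prod_Ioo_ne_top hDf)
  filter_upwards [ae_vertical_primitive_h1 v hD hDf hse hΩ,
    ae_eq_horizontalTrace_add_integral v hD hDf hse hΩ,
    (integrableOn_prod_iff.1 hu).prod_right_ae] with x ⟨hg, _⟩ hx hux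
  have hcd' : Ioo c d ⊆ Ioo s e := Ioo_subset_Ioo hsc hde
  refine abs_sub_setAverage_le (by simpa using hcd) (by simp)
    (IntegrableOn.mono_set (t := Ioo s e) hux hcd') ?_
  filter_upwards [ae_restrict_of_ae_restrict_of_subset hcd' hx,
    ae_restrict_mem measurableSet_Ioo] with y hy hycd
  rw [hy, sub_add_cancel_left, abs_neg, intervalIntegral.integral_of_le (hsc.trans hycd.1.le)]
  exact abs_integral_le_integral_abs.trans <|
    setIntegral_mono_set (hg.mono_set (Ioo_subset_Ioo_right hde)).abs
      (ae_of_all _ fun _ => abs_nonneg _)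
      (LE.le.eventuallyLE fun t ht => ⟨ht.1, ht.2.trans_lt hycd.2⟩)

lemma abs_setAverage_horizontalTrace_sub_le (v : H1 Ω) (hD : IsOpen D) (hDf : volume D ≠ ⊤)
    (hsc : s ≤ c) (hcd : c < d) (hde : d ≤ e) (hΩ : D ×ˢ Ioo s e ⊆ toPlane ⁻¹' Ω) :
    |(⨍ x in D, horizontalTrace v s e x) - ⨍ p in D ×ˢ Ioo c d, h1Rep v (toPlane p)| ≤
      √((d - s) / volume.real D) * ‖v‖ := by
  have hu := integrableOn_comp_toPlane (memLp_h1Rep v)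
    ((prod_mono_right (Ioo_subset_Ioo hsc hde)).trans hΩ) (volume_prod_Ioo_ne_top hDf)
  have hΩ' : D ×ˢ Ioo s d ⊆ toPlane ⁻¹' Ω := (prod_mono_right (Ioo_subset_Ioo_right hde)).trans hΩ
  have hg := (integrableOn_comp_toPlane (memLp_h1Grad_apply v 1) hΩ'
    (volume_prod_Ioo_ne_top hDf)).abs
  have hT := integrableOn_horizontalTrace v hDf hΩ
  have huD := integrableOn_setAverage_right hu
  rw [setAverage_prod hu, ← setAverage_sub hT huD]
  calc _ ≤ (volume.real D)⁻¹ * ∫ x in D, ∫ y in Ioo s d, |h1Grad v (toPlane (x, y)) 1| := by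
        refine (abs_setAverage_le _ _).trans (mul_le_mul_of_nonneg_left ?_ (by positivity))
        exact integral_mono_ae (hT.sub huD).abs (integrableOn_prod_iff.1 hg).integral_prod_left
          (ae_abs_horizontalTrace_sub_setAverage_le v hD hDf hsc hcd hde hΩ)
    _ = (volume.real D)⁻¹ * ∫ p in D ×ˢ Ioo s d, |h1Grad v (toPlane p) 1| := by
        rw [Measure.volume_eq_prod, setIntegral_prod _ hg]
    _ ≤ (volume.real D)⁻¹ * (√(volume.real (D ×ˢ Ioo s d)) * ‖v‖) := by
        gcongr
        exact setIntegral_abs_h1Grad_le v 1 hΩ' (volume_prod_Ioo_ne_top hDf)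
    _ = √((d - s) / volume.real D) * ‖v‖ := by
        rw [← mul_assoc, volume_real_prod_Ioo (hsc.trans hcd.le), inv_mul_sqrt_mul (by positivity)]

end Vertical

section Horizontal

variable {c d : ℝ}

lemma lineDomain_prod_Ioo_subset_of_le {n : ℕ} (hc : lineHeight n ≤ c) (hd : d ≤ 1) :
    lineDomain n ×ˢ Ioo c d ⊆ toPlane ⁻¹' biconeDomain :=
  (prod_mono_right (Ioo_subset_Ioo hc hd)).trans (lineDomain_prod_Ioo_subset n)

lemma ae_isPrimitiveOn_lineDomain (v : H1 biconeDomain) {n : ℕ} (hc : lineHeight n ≤ c)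
    (hd : d ≤ 1) :
    ∀ᵐ y ∂volume.restrict (Ioo c d), IsPrimitiveOn (lineDomain n)
      (fun x => h1Rep v (toPlane (x, y))) (fun x => h1Grad v (toPlane (x, y)) 0) := by
  simp only [IsPrimitiveOn, ae_all_iff]
  intro a b hab hsub
  have hΩ := (prod_mono_left hsub).trans (lineDomain_prod_Ioo_subset_of_le hc hd)
  have hfin : volume (Ioo (a : ℝ) b ×ˢ Ioo c d) ≠ ⊤ := volume_prod_Ioo_ne_top (by simp)
  exact ((isWeakGradient_h1Grad v).ae_horizontal_primitive isOpen_Ioo hab hΩ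
    (integrableOn_comp_toPlane (memLp_h1Rep v) hΩ hfin)
    (integrableOn_comp_toPlane (memLp_h1Grad_apply v 0) hΩ hfin)).mono fun _ => And.right

lemma abs_setAverage_prod_sub_succ_le (v : H1 biconeDomain) {n : ℕ} (hc : lineHeight n ≤ c)
    (hcd : c ≤ d) (hd : d ≤ 1) :
    |(⨍ p in lineDomain n ×ˢ Ioo c d, h1Rep v (toPlane p)) -
        ⨍ p in lineDomain (n + 1) ×ˢ Ioo c d, h1Rep v (toPlane p)| ≤
      2 * (1 / 2) ^ n * (√(volume.real (lineDomain n) / (d - c)) * ‖v‖) := by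
  have hΩ := lineDomain_prod_Ioo_subset_of_le hc hd
  have hfin := volume_prod_Ioo_ne_top (c := c) (d := d) (volume_lineDomain_ne_top n)
  have hu := integrableOn_comp_toPlane (memLp_h1Rep v) hΩ hfin
  have hg := integrableOn_comp_toPlane (memLp_h1Grad_apply v 0) hΩ hfin
  have hu' := hu.mono_set (prod_mono_left (lineDomain_succ_subset n))
  have hI := integrableOn_setAverage_left hu
  have hI' := integrableOn_setAverage_left hu'
  rw [setAverage_prod_symm hu, setAverage_prod_symm hu', ← setAverage_sub hI hI']
  calc _ ≤ (volume.real (Ioo c d))⁻¹ * ∫ y in Ioo c d, 2 * (1 / 2) ^ n *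
          ∫ x in lineDomain n, |h1Grad v (toPlane (x, y)) 0| := by
        refine (abs_setAverage_le _ _).trans (mul_le_mul_of_nonneg_left ?_ (by positivity))
        rw [integrableOn_prod_iff] at hu hg
        refine integral_mono_ae (hI.sub hI').abs
          (hg.abs.integral_prod_right.const_mul _) ?_
        filter_upwards [ae_isPrimitiveOn_lineDomain v hc hd, hu.prod_left_ae, hg.prod_left_ae]
          with y hy huy hgy using abs_setAverage_lineDomain_sub_succ_le n huy hgy hy
    _ = 2 * (1 / 2) ^ n * ((d - c)⁻¹ *
          ∫ p in lineDomain n ×ˢ Ioo c d, |h1Grad v (toPlane p) 0|) := by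
        rw [integral_const_mul, Measure.volume_eq_prod, ← Measure.prod_restrict,
          integral_prod_symm _ (integrableOn_prod_iff.1 hg.abs), Real.volume_real_Ioo_of_le hcd,
          mul_left_comm]
    _ ≤ 2 * (1 / 2) ^ n * ((d - c)⁻¹ * (√(volume.real (lineDomain n ×ˢ Ioo c d)) * ‖v‖)) := by
        have := sub_nonneg.2 hcd
        gcongr
        exact setIntegral_abs_h1Grad_le v 0 hΩ hfin
    _ = 2 * (1 / 2) ^ n * (√(volume.real (lineDomain n) / (d - c)) * ‖v‖) := by
        rw [volume_real_prod_Ioo hcd, ← mul_assoc (d - c)⁻¹, mul_comm (volume.real _),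
          inv_mul_sqrt_mul (sub_nonneg.2 hcd)]

end Horizontal

lemma lineForm_apply (n : ℕ) (v : H1 biconeDomain) :
    lineForm n v = ⨍ x in lineDomain n, horizontalTrace v (lineHeight n) 1 x := by
  rw [setAverage_eq, smul_eq_mul]
  exact averageForm_apply _ _ (lineDomain_prod_Ioo_subset n) v

lemma abs_lineForm_sub_setAverage_le (v : H1 biconeDomain) {n : ℕ} {c d : ℝ}
    (hc : lineHeight n ≤ c) (hcd : c < d) (hd : d ≤ 1) :
    |lineForm n v - ⨍ p in lineDomain n ×ˢ Ioo c d, h1Rep v (toPlane p)| ≤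
      √((d - lineHeight n) / volume.real (lineDomain n)) * ‖v‖ := by
  rw [lineForm_apply]
  exact abs_setAverage_horizontalTrace_sub_le v (isOpen_lineDomain n) (volume_lineDomain_ne_top n)
    hc hcd hd (lineDomain_prod_Ioo_subset n)

lemma pow_sqrt_two_div_two_sq (n : ℕ) : ((√2 / 2) ^ n) ^ 2 = (1 / 2 : ℝ) ^ n := by
  rw [pow_right_comm, div_pow, Real.sq_sqrt zero_le_two]
  norm_num

lemma lineHeight_div_volume_real_lineDomain (n : ℕ) :
    lineHeight n / volume.real (lineDomain n) = ((√2 / 2) ^ n / 2) ^ 2 := by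
  rw [div_pow _ 2, pow_sqrt_two_div_two_sq, lineHeight, volume_real_lineDomain, inv_pow, div_pow,
    div_pow]
  field_simp
  norm_num

lemma sqrt_lineHeight_div_volume_real (n : ℕ) :
    √(lineHeight n / volume.real (lineDomain n)) = (√2 / 2) ^ n / 2 := by
  rw [lineHeight_div_volume_real_lineDomain, Real.sqrt_sq (by positivity)]

lemma sqrt_five_mul_lineHeight_succ_div_le (n : ℕ) :
    √(5 * lineHeight (n + 1) / volume.real (lineDomain (n + 1))) ≤ (√2 / 2) ^ n := by
  rw [mul_div_assoc, lineHeight_div_volume_real_lineDomain]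
  refine Real.sqrt_le_iff.2 ⟨by positivity, ?_⟩
  calc 5 * ((√2 / 2) ^ (n + 1) / 2) ^ 2 = 5 / 16 * √2 ^ 2 * ((√2 / 2) ^ n) ^ 2 := by ring
    _ ≤ ((√2 / 2) ^ n) ^ 2 := by
      rw [Real.sq_sqrt zero_le_two]
      linarith [sq_nonneg ((√2 / 2) ^ n)]

lemma two_mul_half_pow_mul_sqrt_div (n : ℕ) :
    2 * (1 / 2) ^ n * √(volume.real (lineDomain n) / lineHeight n) = 4 * (√2 / 2) ^ n := by
  rw [← inv_div (lineHeight n), Real.sqrt_inv, sqrt_lineHeight_div_volume_real,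
    ← pow_sqrt_two_div_two_sq, inv_div]
  have : (√2 / 2) ^ n ≠ 0 := by positivity
  field_simp
  norm_num

lemma abs_lineForm_sub_succ_le (n : ℕ) (v : H1 biconeDomain) :
    |lineForm n v - lineForm (n + 1) v| ≤ 6 * (√2 / 2) ^ n * ‖v‖ := by
  have hs := lineHeight_pos n
  have hs1 : 2 * lineHeight n ≤ 1 := by linarith [lineHeight_le n]
  have hlt : lineHeight n < 2 * lineHeight n := by linarith
  have hsucc : lineHeight (n + 1) ≤ lineHeight n := by rw [lineHeight_succ]; linarith
  have hlen : 2 * lineHeight n - lineHeight n = lineHeight n := by ring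
  have hlen' : 2 * lineHeight n - lineHeight (n + 1) = 5 * lineHeight (n + 1) := by
    rw [lineHeight_succ]; ring
  have bound : √((2 * lineHeight n - lineHeight n) / volume.real (lineDomain n)) +
      (2 * (1 / 2) ^ n * √(volume.real (lineDomain n) / (2 * lineHeight n - lineHeight n)) +
        √((2 * lineHeight n - lineHeight (n + 1)) / volume.real (lineDomain (n + 1)))) ≤
      6 * (√2 / 2) ^ n := by
    rw [hlen, hlen', sqrt_lineHeight_div_volume_real, two_mul_half_pow_mul_sqrt_div]
    have : 0 ≤ (√2 / 2) ^ n := by positivity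
    linarith [sqrt_five_mul_lineHeight_succ_div_le n]
  have vertical := abs_lineForm_sub_setAverage_le v le_rfl hlt hs1
  have horizontal := abs_setAverage_prod_sub_succ_le v le_rfl hlt.le hs1
  have vertical_succ := abs_lineForm_sub_setAverage_le v hsucc hlt hs1
  calc |lineForm n v - lineForm (n + 1) v|
      ≤ _ + (_ + _) := (abs_sub_le _ _ _).trans (add_le_add vertical
        ((abs_sub_le _ _ _).trans (add_le_add horizontal ((abs_sub_comm _ _).trans_le
          vertical_succ))))
    _ = _ * ‖v‖ := by rw [← mul_assoc, ← add_mul, ← add_mul]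
    _ ≤ 6 * (√2 / 2) ^ n * ‖v‖ := mul_le_mul_of_nonneg_right bound (norm_nonneg v)

lemma exists_tendsto_of_abs_sub_succ_le {X : Type*} [NormedAddCommGroup X] [NormedSpace ℝ X]
    {L : ℕ → X →L[ℝ] ℝ} {C r : ℝ} (hC : 0 ≤ C) (hr : 0 ≤ r) (hr1 : r < 1)
    (h : ∀ n v, |L n v - L (n + 1) v| ≤ C * r ^ n * ‖v‖) : ∃ L', Tendsto L atTop (𝓝 L') := by
  refine cauchySeq_tendsto_of_complete (cauchySeq_of_le_geometric r C hr1 fun n => ?_)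
  rw [dist_eq_norm]
  exact ContinuousLinearMap.opNorm_le_bound _ (by positivity) (h n)

lemma exists_tendsto_lineForm :
    ∃ L : H1 biconeDomain →L[ℝ] ℝ, Tendsto lineForm atTop (𝓝 L) := by
  have hlt : √2 / 2 < 1 := by rw [div_lt_one two_pos, Real.sqrt_lt' two_pos]; norm_num
  exact exists_tendsto_of_abs_sub_succ_le (X := H1 biconeDomain) (by norm_num) (by positivity)
    hlt abs_lineForm_sub_succ_le

/-- The limit `ν̄` of the linear forms `ν_n`. -/
def limitForm : H1 biconeDomain →L[ℝ] ℝ := exists_tendsto_lineForm.choose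

lemma tendsto_lineForm : Tendsto lineForm atTop (𝓝 limitForm) :=
  exists_tendsto_lineForm.choose_spec

/-! ## Composition with isometries -/

section Isometry

variable {d : ℕ} {Ω Ω' : Set (EuclideanSpace ℝ (Fin d))}
  (e : EuclideanSpace ℝ (Fin d) ≃ₗᵢ[ℝ] EuclideanSpace ℝ (Fin d))

lemma IsTestFunction.comp_isometry {φ : EuclideanSpace ℝ (Fin d) → ℝ} (hφ : IsTestFunction Ω' φ)
    (h : e ⁻¹' Ω = Ω') : IsTestFunction Ω (φ ∘ e.symm) := by
  refine ⟨hφ.1.comp e.symm.contDiff, hφ.2.1.comp_homeomorph e.symm.toHomeomorph, ?_⟩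
  rw [show φ ∘ e.symm = φ ∘ e.symm.toHomeomorph from rfl,
    tsupport_comp_eq_preimage φ e.symm.toHomeomorph]
  intro x hx
  simpa [← h] using hφ.2.2 hx

lemma measurePreserving_restrict_isometry (h : e ⁻¹' Ω = Ω') :
    MeasurePreserving e (volume.restrict Ω') (volume.restrict Ω) :=
  h ▸ e.measurePreserving.restrict_preimage_emb e.toHomeomorph.measurableEmbedding Ω

lemma IsWeakGradient.comp_isometry {u : EuclideanSpace ℝ (Fin d) → ℝ}
    {g : EuclideanSpace ℝ (Fin d) → EuclideanSpace ℝ (Fin d)} (hu : IsWeakGradient Ω u g)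
    (h : e ⁻¹' Ω = Ω') : IsWeakGradient Ω' (u ∘ e) (e.symm ∘ g ∘ e) := by
  intro φ hφ v
  have hint (F : EuclideanSpace ℝ (Fin d) → ℝ) : ∫ x in Ω, F x = ∫ x in Ω', F (e x) :=
    ((measurePreserving_restrict_isometry e h).integral_comp
      e.toHomeomorph.measurableEmbedding F).symm
  have hderiv (x : EuclideanSpace ℝ (Fin d)) :
      fderiv ℝ (φ ∘ e.symm) (e x) (e v) = fderiv ℝ φ x v := by
    simpa using congrArg (fun L => L (e v))
      (e.symm.toContinuousLinearEquiv.comp_right_fderiv (f := φ) (x := e x))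
  have key := hu _ (hφ.comp_isometry e h) (e v)
  rw [hint, hint] at key
  simpa [hderiv, e.symm.inner_map_eq_flip] using key

/-- The composition `v ↦ v ∘ e` with an isometry `e : Ω' → Ω`, as a map from `H¹(Ω)` to `H¹(Ω')`;
the gradient of `v ∘ e` is `e⁻¹ ∘ ∇v ∘ e`. -/
def h1CompIsometry (h : e ⁻¹' Ω = Ω') : H1 Ω →L[ℝ] H1 Ω' :=
  let hmp := measurePreserving_restrict_isometry e h
  let value := (Lp.compMeasurePreservingₗᵢ ℝ (E := ℝ) (p := 2) e hmp).toContinuousLinearMap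
  let gradient := ((e.symm.toContinuousLinearEquiv : EuclideanSpace ℝ (Fin d) →L[ℝ]
    EuclideanSpace ℝ (Fin d)).compLpL 2 (volume.restrict Ω')).comp
      (Lp.compMeasurePreservingₗᵢ ℝ e hmp).toContinuousLinearMap
  let toProd := (WithLp.prodContinuousLinearEquiv 2 ℝ (Lp ℝ 2 (volume.restrict Ω))
    (Lp (EuclideanSpace ℝ (Fin d)) 2 (volume.restrict Ω))).toContinuousLinearMap
  let ofProd := (WithLp.prodContinuousLinearEquiv 2 ℝ (Lp ℝ 2 (volume.restrict Ω'))
    (Lp (EuclideanSpace ℝ (Fin d)) 2 (volume.restrict Ω'))).symm.toContinuousLinearMap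
  (ofProd.comp ((value.prodMap gradient).comp (toProd.comp (H1 Ω).subtypeL))).codRestrict (H1 Ω')
    fun v => by
      refine (IsWeakGradient.comp_isometry e v.2 h).congr
        (Lp.coeFn_compMeasurePreserving v.1.fst hmp) ?_
      filter_upwards [ContinuousLinearMap.coeFn_compLpL (p := 2) (μ := volume.restrict Ω')
        (e.symm.toContinuousLinearEquiv :
          EuclideanSpace ℝ (Fin d) →L[ℝ] EuclideanSpace ℝ (Fin d))
        (Lp.compMeasurePreserving e hmp v.1.snd),
        Lp.coeFn_compMeasurePreserving v.1.snd hmp] with x hx hx'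
      exact hx.trans (congrArg e.symm hx')

lemma h1Rep_h1CompIsometry (h : e ⁻¹' Ω = Ω') (v : H1 Ω) :
    h1Rep (h1CompIsometry e h v) =ᵐ[volume.restrict Ω'] fun x => h1Rep v (e x) :=
  Lp.coeFn_compMeasurePreserving v.1.fst (measurePreserving_restrict_isometry e h)

end Isometry

/-- The map `v ↦ v ∘ ψ` on `H¹(Ω)`. -/
def reflectH1 : H1 biconeDomain →L[ℝ] H1 biconeDomain :=
  h1CompIsometry reflectIsometry preimage_reflect_biconeDomain

lemma h1Rep_reflectH1 (v : H1 biconeDomain) :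
    h1Rep (reflectH1 v) =ᵐ[volume.restrict biconeDomain] fun x => h1Rep v (reflect x) :=
  h1Rep_h1CompIsometry reflectIsometry preimage_reflect_biconeDomain v

/-! ## Averages of continuous functions -/

lemma neBot_nhds_inf_ae {X : Type*} [TopologicalSpace X] [MeasurableSpace X] (μ : Measure X)
    [μ.IsOpenPosMeasure] (x : X) : (𝓝 x ⊓ ae μ).NeBot := by
  refine inf_neBot_iff.2 fun s hs t ht => ?_
  by_contra h
  have hst : s ⊆ tᶜ := fun y hys hyt => h ⟨y, hys, hyt⟩
  exact (Measure.measure_pos_of_mem_nhds μ hs).ne' (measure_mono_null hst ht)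

section ContinuousOn

variable {Ω : Set (EuclideanSpace ℝ (Fin 2))} {f : EuclideanSpace ℝ (Fin 2) → ℝ} {c : ℝ}
  {D : Set ℝ}

lemma IsHorizontalTrace.ae_eq_of_continuousOn {u : EuclideanSpace ℝ (Fin 2) → ℝ} {t : ℝ → ℝ}
    (ht : IsHorizontalTrace u c D t) (hΩ : IsOpen Ω) (hDm : MeasurableSet D)
    (hD : ∀ x ∈ D, !₂[x, c] ∈ Ω) (hf : ContinuousOn f Ω) (hu : u =ᵐ[volume.restrict Ω] f) :
    t =ᵐ[volume.restrict D] fun x => f !₂[x, c] := by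
  have hprod : ∀ᵐ p ∂(volume : Measure ℝ).prod volume,
      toPlane p ∈ Ω → u (toPlane p) = f (toPlane p) :=
    measurePreserving_toPlane.quasiMeasurePreserving.ae
      ((ae_restrict_iff' hΩ.measurableSet).1 hu)
  filter_upwards [ht, ae_restrict_of_ae (Measure.ae_ae_of_ae_prod hprod), ae_restrict_mem hDm]
    with x htx hux hxD
  have hline : Continuous fun y : ℝ => toPlane (x, y) := continuous_toPlane.comp (by fun_prop)
  have hlim : Tendsto (fun y : ℝ => f !₂[x, y]) (𝓝 c) (𝓝 (f !₂[x, c])) :=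
    (hf.continuousAt (hΩ.mem_nhds (hD x hxD))).tendsto.comp hline.continuousAt
  have := neBot_nhds_inf_ae volume c
  refine tendsto_nhds_unique htx ((hlim.mono_left inf_le_left).congr' ?_)
  filter_upwards [mem_inf_of_left ((hΩ.preimage hline).mem_nhds (hD x hxD)),
    mem_inf_of_right hux] with y hyΩ huy using (huy hyΩ).symm

lemma IsHorizontalAverage.eq_setAverage_of_continuousOn {L : H1 Ω →L[ℝ] ℝ}
    (hL : IsHorizontalAverage Ω c D L) (hΩ : IsOpen Ω) (hDm : MeasurableSet D)
    (hD : ∀ x ∈ D, !₂[x, c] ∈ Ω) (hf : ContinuousOn f Ω) {v : H1 Ω}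
    (hv : h1Rep v =ᵐ[volume.restrict Ω] f) :
    IntegrableOn (fun x => f !₂[x, c]) D ∧ L v = ⨍ x in D, f !₂[x, c] := by
  obtain ⟨t, ht, hti, hLt⟩ := hL v
  have htf := ht.ae_eq_of_continuousOn hΩ hDm hD hf hv
  exact ⟨hti.congr htf, by rw [hLt, integral_congr_ae htf, setAverage_eq, smul_eq_mul]⟩

end ContinuousOn

lemma mk_lineHeight_mem {n : ℕ} {x : ℝ} (hx : x ∈ lineDomain n) :
    !₂[x, lineHeight n] ∈ biconeDomain := Or.inl hx

lemma mk_neg_lineHeight_mem {n : ℕ} {x : ℝ} (hx : x ∈ lineDomain n) :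
    !₂[x, -lineHeight n] ∈ biconeDomain := Or.inr ⟨_, hx, by simp [reflect]⟩

section LineForm

variable {f : EuclideanSpace ℝ (Fin 2) → ℝ} {v : H1 biconeDomain}

lemma lineForm_of_continuousOn (n : ℕ) (hf : ContinuousOn f biconeDomain)
    (hv : h1Rep v =ᵐ[volume.restrict biconeDomain] f) :
    IntegrableOn (fun x => f !₂[x, lineHeight n]) (lineDomain n) ∧
      lineForm n v = ⨍ x in lineDomain n, f !₂[x, lineHeight n] :=
  (isHorizontalAverage_lineForm n).eq_setAverage_of_continuousOn isOpen_biconeDomain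
    (measurableSet_lineDomain n) (fun _ => mk_lineHeight_mem) hf hv

lemma lineForm_reflectH1_of_continuousOn (n : ℕ) (hf : ContinuousOn f biconeDomain)
    (hv : h1Rep v =ᵐ[volume.restrict biconeDomain] f) :
    IntegrableOn (fun x => f !₂[x, -lineHeight n]) (lineDomain n) ∧
      lineForm n (reflectH1 v) = ⨍ x in lineDomain n, f !₂[x, -lineHeight n] := by
  have hfψ : ContinuousOn (fun x => f (reflect x)) biconeDomain :=
    hf.comp reflectIsometry.continuous.continuousOn preimage_reflect_biconeDomain.ge
  have hvψ : h1Rep (reflectH1 v) =ᵐ[volume.restrict biconeDomain] fun x => f (reflect x) :=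
    (h1Rep_reflectH1 v).trans ((measurePreserving_restrict_isometry reflectIsometry
      preimage_reflect_biconeDomain).quasiMeasurePreserving.ae hv)
  simpa [reflect] using lineForm_of_continuousOn n hfψ hvψ

lemma tendsto_lineHeight : Tendsto lineHeight atTop (𝓝 0) := by
  have h := (tendsto_pow_atTop_nhds_zero_of_lt_one (r := (3 : ℝ)⁻¹) (by norm_num)
    (by norm_num)).div_const 2
  rwa [zero_div] at h

lemma dist_mk_neg (x y : ℝ) : dist !₂[x, y] !₂[x, -y] = 2 * |y| := by
  rw [EuclideanSpace.dist_eq, Fin.sum_univ_two]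
  simp [Real.dist_eq, ← two_mul, abs_mul]

lemma tendsto_setAverage_lineDomain_sub (hf : ContinuousOn f (closure biconeDomain))
    (hup : ∀ n, IntegrableOn (fun x => f !₂[x, lineHeight n]) (lineDomain n))
    (hdown : ∀ n, IntegrableOn (fun x => f !₂[x, -lineHeight n]) (lineDomain n)) :
    Tendsto (fun n => ⨍ x in lineDomain n, (f !₂[x, lineHeight n] - f !₂[x, -lineHeight n]))
      atTop (𝓝 0) := by
  have huc := isBounded_biconeDomain.isCompact_closure.uniformContinuousOn_of_continuous hf
  refine Metric.tendsto_atTop'.2 fun ε hε => ?_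
  obtain ⟨δ, hδ, hfδ⟩ := Metric.uniformContinuousOn_iff.1 huc (ε / 2) (half_pos hε)
  obtain ⟨N, hN⟩ := eventually_atTop.1 (tendsto_lineHeight.eventually_lt_const (half_pos hδ))
  refine ⟨N, fun n hn => lt_of_le_of_lt ?_ (half_lt_self hε)⟩
  rw [dist_comm, Real.dist_eq]
  refine abs_sub_setAverage_le (volume_lineDomain_ne_zero n) (volume_lineDomain_ne_top n)
    ((hup n).sub (hdown n)) ?_
  filter_upwards [ae_restrict_mem (measurableSet_lineDomain n)] with x hx
  have hdist : dist !₂[x, lineHeight n] !₂[x, -lineHeight n] < δ := by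
    rw [dist_mk_neg, abs_of_pos (lineHeight_pos n)]
    linarith [hN n hn.le]
  rw [zero_sub, abs_neg, ← Real.dist_eq]
  exact (hfδ _ (subset_closure (mk_lineHeight_mem hx)) _
    (subset_closure (mk_neg_lineHeight_mem hx)) hdist).le

end LineForm

lemma tendsto_clm_apply {X : Type*} [NormedAddCommGroup X] [NormedSpace ℝ X]
    {L : ℕ → X →L[ℝ] ℝ} {M : X →L[ℝ] ℝ} (h : Tendsto L atTop (𝓝 M)) (v : X) :
    Tendsto (fun n => L n v) atTop (𝓝 (M v)) :=
  ((ContinuousLinearMap.apply ℝ ℝ v).continuous.tendsto M).comp h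

lemma tendsto_lineForm_apply (v : H1 biconeDomain) :
    Tendsto (fun n => lineForm n v) atTop (𝓝 (limitForm v)) :=
  tendsto_clm_apply (X := H1 biconeDomain) tendsto_lineForm v

lemma limitForm_sub_reflectH1_of_continuousOn {f : EuclideanSpace ℝ (Fin 2) → ℝ}
    {v : H1 biconeDomain} (hf : ContinuousOn f (closure biconeDomain))
    (hv : h1Rep v =ᵐ[volume.restrict biconeDomain] f) :
    (limitForm - limitForm.comp reflectH1) v = 0 := by
  have hup n := lineForm_of_continuousOn n (hf.mono subset_closure) hv
  have hdown n := lineForm_reflectH1_of_continuousOn n (hf.mono subset_closure) hv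
  have hdiff (n : ℕ) : ⨍ x in lineDomain n, (f !₂[x, lineHeight n] - f !₂[x, -lineHeight n]) =
      lineForm n v - lineForm n (reflectH1 v) :=
    (setAverage_sub (hup n).1 (hdown n).1).trans
      (congrArg₂ (· - ·) (hup n).2.symm (hdown n).2.symm)
  exact tendsto_nhds_unique
    (((tendsto_lineForm_apply v).sub (tendsto_lineForm_apply (reflectH1 v))).congr
      fun n => (hdiff n).symm)
    (tendsto_setAverage_lineDomain_sub hf (fun n => (hup n).1) fun n => (hdown n).1)

lemma clm_eq_zero_of_mem_closure {X : Type*} [NormedAddCommGroup X] [NormedSpace ℝ X]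
    {L : X →L[ℝ] ℝ} {S : Set X} (h : ∀ v ∈ S, L v = 0) {v : X} (hv : v ∈ closure S) : L v = 0 :=
  closure_minimal h (isClosed_singleton.preimage L.continuous) hv

lemma limitForm_sub_reflectH1_of_mem_H1tilde {v : H1 biconeDomain}
    (hv : v ∈ H1tilde biconeDomain) : (limitForm - limitForm.comp reflectH1) v = 0 :=
  clm_eq_zero_of_mem_closure (X := H1 biconeDomain)
    (L := limitForm - limitForm.comp reflectH1)
    (fun _ hw => hw.elim fun _ hf => limitForm_sub_reflectH1_of_continuousOn hf.1 hf.2) hv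

/-! ## Locally constant functions -/

section LocallyConstant

lemma continuousOn_of_eventually_eq {X Y : Type*} [TopologicalSpace X] [TopologicalSpace Y]
    {f : X → Y} {s : Set X} (hf : ∀ x ∈ s, ∀ᶠ y in 𝓝 x, f y = f x) : ContinuousOn f s :=
  fun x hx => (continuousAt_const.congr ((hf x hx).mono fun _ h => h.symm)).continuousWithinAt

variable {E : Type*} [NormedAddCommGroup E] [InnerProductSpace ℝ E]

lemma IsTestFunction.mul_of_eventually_eq {Ω : Set E} {f φ : E → ℝ} (hφ : IsTestFunction Ω φ)
    (hf : ∀ x ∈ Ω, ∀ᶠ y in 𝓝 x, f y = f x) : IsTestFunction Ω fun x => f x * φ x := by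
  refine ⟨contDiff_iff_contDiffAt.2 fun x => ?_, hφ.2.1.mul_left,
    (tsupport_mul_subset_right (f := f)).trans hφ.2.2⟩
  by_cases hx : x ∈ tsupport φ
  · refine (contDiffAt_const.mul hφ.1.contDiffAt).congr_of_eventuallyEq (f := fun y => f x * φ y) ?_
    exact (hf x (hφ.2.2 hx)).mono fun y hy => by simp only [hy]
  · refine contDiffAt_const.congr_of_eventuallyEq (f := fun _ => 0) ?_
    filter_upwards [(isClosed_tsupport φ).isOpen_compl.mem_nhds hx] with y hy
    rw [image_eq_zero_of_notMem_tsupport hy, mul_zero]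

variable [FiniteDimensional ℝ E] [MeasureSpace E] [BorelSpace E]
  [(volume : Measure E).IsAddHaarMeasure]

lemma integral_fderiv_eq_zero {φ : E → ℝ} (hφ : ContDiff ℝ 1 φ) (hc : HasCompactSupport φ)
    (v : E) : ∫ x, fderiv ℝ φ x v = 0 := by
  have hderiv : Integrable fun x => fderiv ℝ φ x v :=
    ((hφ.continuous_fderiv one_ne_zero).clm_apply
      continuous_const).integrable_of_hasCompactSupport (hc.fderiv_apply ℝ v)
  simpa using integral_mul_fderiv_eq_neg_fderiv_mul_of_integrable (μ := (volume : Measure E))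
    (f := fun _ => (1 : ℝ)) (g := φ) (v := v) (by simp) (by simpa using hderiv)
    (by simpa using hφ.continuous.integrable_of_hasCompactSupport hc) (by simp)
    fun x _ => hφ.differentiable one_ne_zero x

variable {Ω : Set E} {f : E → ℝ}

lemma isWeakGradient_zero_of_eventually_eq (hΩ : MeasurableSet Ω)
    (hf : ∀ x ∈ Ω, ∀ᶠ y in 𝓝 x, f y = f x) : IsWeakGradient Ω f fun _ => 0 := by
  intro φ hφ v
  have hfφ := hφ.mul_of_eventually_eq hf
  have hin : ∀ x ∈ Ω, f x * fderiv ℝ φ x v = fderiv ℝ (fun y => f y * φ y) x v := by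
    intro x hx
    have hx' : (fun y => f y * φ y) =ᶠ[𝓝 x] fun y => f x * φ y :=
      (hf x hx).mono fun y hy => by simp only [hy]
    rw [hx'.fderiv_eq, fderiv_const_mul (hφ.1.differentiable (by simp) x)]
    rfl
  have hout : ∀ x ∉ Ω, fderiv ℝ (fun y => f y * φ y) x v = 0 := by
    intro x hx
    rw [image_eq_zero_of_notMem_tsupport fun h => hx (hfφ.2.2 (tsupport_fderiv_subset ℝ h)),
      zero_apply]
  rw [setIntegral_congr_fun hΩ hin, setIntegral_eq_integral_of_forall_compl_eq_zero hout,
    integral_fderiv_eq_zero (hfφ.1.of_le (by simp)) hfφ.2.1]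
  simp

lemma memH1_of_eventually_eq (hΩ : MeasurableSet Ω) (hΩb : Bornology.IsBounded Ω) {C : ℝ}
    (hfC : ∀ x, |f x| ≤ C) (hf : ∀ x ∈ Ω, ∀ᶠ y in 𝓝 x, f y = f x) : MemH1 Ω f := by
  have : IsFiniteMeasure (volume.restrict Ω) := isFiniteMeasure_restrict.2 hΩb.measure_lt_top.ne
  exact ⟨.of_bound ((continuousOn_of_eventually_eq hf).aestronglyMeasurable hΩ) C
    (ae_of_all _ hfC), fun _ => 0, .zero', isWeakGradient_zero_of_eventually_eq hΩ hf⟩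

end LocallyConstant

lemma MemH1.exists_h1Rep_ae_eq {d : ℕ} {Ω : Set (EuclideanSpace ℝ (Fin d))}
    {f : EuclideanSpace ℝ (Fin d) → ℝ} (hf : MemH1 Ω f) :
    ∃ u : H1 Ω, h1Rep u =ᵐ[volume.restrict Ω] f := by
  obtain ⟨hf2, g, hg2, hfg⟩ := hf
  exact ⟨⟨WithLp.toLp 2 (hf2.toLp f, hg2.toLp g), hfg.congr hf2.coeFn_toLp hg2.coeFn_toLp⟩,
    hf2.coeFn_toLp⟩

/-! ## Omnidirectional traces of locally constant functions -/

section Omnidirectional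

variable {d : ℕ} {Ω : Set (EuclideanSpace ℝ (Fin d))} {f : EuclideanSpace ℝ (Fin d) → ℝ} {C : ℝ}

lemma directionalMeasure_univ_le (Ω : Set (EuclideanSpace ℝ (Fin d)))
    (θ : EuclideanSpace ℝ (Fin d)) : directionalMeasure Ω θ univ ≤ volume Ω := by
  rw [directionalMeasure]
  by_cases h : AEMeasurable (exitPoint Ω θ) (volume.restrict Ω)
  · simp [Measure.map_apply_of_aemeasurable h]
  · simp [Measure.map_of_not_aemeasurable h]

lemma memL2Directional_of_abs_le (hΩ : volume Ω ≠ ⊤) (hfm : Measurable f)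
    (hfC : ∀ x, |f x| ≤ C) : MemL2Directional Ω f := by
  refine ⟨C ^ 2 * volume.real Ω, fun θ _ => ?_⟩
  have hle := directionalMeasure_univ_le Ω θ
  have : IsFiniteMeasure (directionalMeasure Ω θ) := ⟨hle.trans_lt hΩ.lt_top⟩
  refine ⟨.of_bound hfm.aestronglyMeasurable C (ae_of_all _ hfC), ?_⟩
  calc ∫ z, f z ^ 2 ∂directionalMeasure Ω θ
      ≤ ∫ _, C ^ 2 ∂directionalMeasure Ω θ :=
        integral_mono_of_nonneg (ae_of_all _ fun _ => sq_nonneg _) (integrable_const _)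
          (ae_of_all _ fun z => sq_le_sq' (abs_le.1 (hfC z)).1 (abs_le.1 (hfC z)).2)
    _ = C ^ 2 * (directionalMeasure Ω θ).real univ := by
        rw [integral_const, smul_eq_mul, mul_comm]
    _ ≤ C ^ 2 * volume.real Ω := by
        gcongr
        exact ENNReal.toReal_mono hΩ hle

variable {θ : EuclideanSpace ℝ (Fin d)}

lemma lipschitzWith_hyperplaneProj (θ : EuclideanSpace ℝ (Fin d)) :
    ∃ K, LipschitzWith K (hyperplaneProj θ) := by
  let P : EuclideanSpace ℝ (Fin d) →L[ℝ] EuclideanSpace ℝ (Fin d) :=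
    .id ℝ _ - (innerSL ℝ θ).smulRight θ
  exact ⟨‖P‖₊, (funext fun x => by simp [P, hyperplaneProj, real_inner_comm] :
    ⇑P = hyperplaneProj θ) ▸ P.lipschitz⟩

lemma hausdorffMeasure_hyperplaneProj_image_eq_zero (hθ : θ ≠ 0)
    {N : Set (EuclideanSpace ℝ (Fin d))} (hN : μH[(d : ℝ) - 1] N = 0) :
    μH[(d : ℝ) - 1] (hyperplaneProj θ '' N) = 0 := by
  obtain ⟨K, hK⟩ := lipschitzWith_hyperplaneProj θ
  have hd : d ≠ 0 := by
    rintro rfl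
    exact hθ (Subsingleton.elim _ _)
  have hd1 : (0 : ℝ) ≤ d - 1 := sub_nonneg.2 (Nat.one_le_cast.2 (Nat.one_le_iff_ne_zero.2 hd))
  exact le_antisymm ((hK.hausdorffMeasure_image_le hd1 N).trans_eq (by rw [hN, mul_zero]))
    zero_le

lemma hyperplaneProj_smul_add_hyperplaneProj (hθ : ‖θ‖ = 1) (s : ℝ)
    (x : EuclideanSpace ℝ (Fin d)) :
    hyperplaneProj θ (s • θ + hyperplaneProj θ x) = hyperplaneProj θ x := by
  have hinner : ⟪s • θ + hyperplaneProj θ x, θ⟫ = s := by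
    simp [hyperplaneProj, inner_add_left, inner_sub_left, real_inner_smul_left, hθ]
  rw [hyperplaneProj, hinner, add_sub_cancel_left]

lemma isBounded_lineSection (hΩ : Bornology.IsBounded Ω) (hθ : ‖θ‖ = 1)
    (y : EuclideanSpace ℝ (Fin d)) : Bornology.IsBounded (lineSection Ω θ y) := by
  have hline : Isometry fun s : ℝ => s • θ + y := Isometry.of_dist_eq fun s t => by
    rw [dist_add_right, dist_eq_norm, ← sub_smul, norm_smul, hθ, mul_one, dist_eq_norm]
  exact hline.antilipschitz.isBounded_preimage hΩ

lemma isDirectionalTrace_of_eventually_eq (hΩ : IsOpen Ω) (hΩb : Bornology.IsBounded Ω)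
    (hfC : ∀ x, |f x| ≤ C) {N : Set (EuclideanSpace ℝ (Fin d))} (hN : μH[(d : ℝ) - 1] N = 0)
    (hf : ∀ x ∈ closure Ω \ N, ∀ᶠ y in 𝓝 x, f y = f x) {u : EuclideanSpace ℝ (Fin d) → ℝ}
    (hu : u =ᵐ[volume.restrict Ω] f) (hθ : ‖θ‖ = 1) : IsDirectionalTrace Ω θ u f := by
  have hθ0 : θ ≠ 0 := by
    rintro rfl
    simp at hθ
  refine ⟨f, hu.symm, (hyperplaneProj θ '' Ω) \ (hyperplaneProj θ '' N), sdiff_subset, ?_, ?_⟩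
  · exact measure_mono_null (by simp [sdiff_sdiff_right_self])
      (hausdorffMeasure_hyperplaneProj_image_eq_zero hθ0 hN)
  rintro y ⟨⟨x, -, rfl⟩, hxN⟩
  set line : ℝ → EuclideanSpace ℝ (Fin d) := fun s => s • θ + hyperplaneProj θ x
  have hline : Continuous line := by fun_prop
  have hlineN (s : ℝ) : line s ∉ N := fun hs =>
    hxN ⟨line s, hs, hyperplaneProj_smul_add_hyperplaneProj hθ s x⟩
  have hconst (s : ℝ) (hs : line s ∈ closure Ω) : ∀ᶠ t in 𝓝 s, f (line t) = f (line s) :=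
    hline.continuousAt.eventually (hf _ ⟨hs, hlineN s⟩)
  refine ⟨memH1_of_eventually_eq (hΩ.preimage hline).measurableSet
    (isBounded_lineSection hΩb hθ _) (fun _ => hfC _)
    fun s hs => hconst s (subset_closure hs), fun α β hαβ hsub _ _ => ?_⟩
  refine ⟨fun s => f (line s), continuousOn_of_eventually_eq fun s hs => hconst s ?_,
    ae_of_all _ fun _ => rfl, rfl⟩
  refine map_mem_closure hline ?_ hsub
  rw [closure_Ioo hαβ.ne]
  exact Ioc_subset_Icc_self hs

lemma mem_H1tr_of_eventually_eq (hΩ : IsOpen Ω) (hΩb : Bornology.IsBounded Ω)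
    (hfm : Measurable f) (hfC : ∀ x, |f x| ≤ C) {N : Set (EuclideanSpace ℝ (Fin d))}
    (hN : μH[(d : ℝ) - 1] N = 0) (hf : ∀ x ∈ closure Ω \ N, ∀ᶠ y in 𝓝 x, f y = f x)
    {u : H1 Ω} (hu : h1Rep u =ᵐ[volume.restrict Ω] f) : u ∈ H1tr Ω :=
  ⟨f, memL2Directional_of_abs_le hΩb.measure_lt_top.ne hfm hfC, fun _ hθ =>
    ⟨f, isDirectionalTrace_of_eventually_eq hΩ hΩb hfC hN hf hu (by simpa using hθ), .rfl⟩⟩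

end Omnidirectional

/-! ## The function `1` above and `-1` below the axis -/

/-- The function `û`: it is `1` on `Ω_C` and `-1` on its mirror image. Its values outside
`biconeDomain` serve as its trace, and the value `-1` on the axis is an arbitrary choice. -/
def heightSign (x : EuclideanSpace ℝ (Fin 2)) : ℝ := if 0 < x 1 then 1 else -1

lemma heightSign_of_pos {x : EuclideanSpace ℝ (Fin 2)} (hx : 0 < x 1) : heightSign x = 1 :=
  if_pos hx

lemma heightSign_of_neg {x : EuclideanSpace ℝ (Fin 2)} (hx : x 1 < 0) : heightSign x = -1 :=
  if_neg hx.not_gt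

lemma abs_heightSign_le (x : EuclideanSpace ℝ (Fin 2)) : |heightSign x| ≤ 1 := by
  unfold heightSign
  split_ifs <;> simp

lemma measurable_heightSign : Measurable heightSign :=
  .ite (measurableSet_lt measurable_const (by fun_prop)) measurable_const measurable_const

lemma heightSign_eventually_eq {x : EuclideanSpace ℝ (Fin 2)} (hx : x 1 ≠ 0) :
    ∀ᶠ y in 𝓝 x, heightSign y = heightSign x := by
  have hcont : ContinuousAt (fun y : EuclideanSpace ℝ (Fin 2) => y 1) x := by fun_prop
  rcases lt_or_gt_of_ne hx with hneg | hpos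
  · filter_upwards [hcont.eventually_lt_const hneg] with y hy
    rw [heightSign_of_neg hneg, heightSign_of_neg hy]
  · filter_upwards [hcont.eventually_const_lt hpos] with y hy
    rw [heightSign_of_pos hpos, heightSign_of_pos hy]

lemma heightSign_eventually_eq_of_mem {x : EuclideanSpace ℝ (Fin 2)} (hx : x ∈ biconeDomain) :
    ∀ᶠ y in 𝓝 x, heightSign y = heightSign x :=
  heightSign_eventually_eq (abs_pos.1 (mem_biconeDomain_iff.1 hx).1)

lemma exists_h1Rep_ae_eq_heightSign :
    ∃ u : H1 biconeDomain, h1Rep u =ᵐ[volume.restrict biconeDomain] heightSign :=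
  (memH1_of_eventually_eq isOpen_biconeDomain.measurableSet isBounded_biconeDomain
    abs_heightSign_le fun _ => heightSign_eventually_eq_of_mem).exists_h1Rep_ae_eq

lemma mem_cantorSet_of_mem_closure_biconeDomain {x : EuclideanSpace ℝ (Fin 2)}
    (hx : x ∈ closure biconeDomain) (hx1 : x 1 = 0) : x 0 ∈ cantorSet := by
  have hclosed : IsClosed {y : EuclideanSpace ℝ (Fin 2) |
      Metric.infDist (y 0) cantorSet ≤ |y 1|} :=
    isClosed_le ((Metric.continuous_infDist_pt _).comp (by fun_prop)) (by fun_prop)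
  have hle : Metric.infDist (x 0) cantorSet ≤ |x 1| := by
    refine closure_minimal (fun y hy => ?_) hclosed hx
    obtain ⟨a, ha, hya⟩ := Metric.mem_thickening_iff.1 (mem_biconeDomain_iff.1 hy).2.2
    exact (Metric.infDist_le_dist_of_mem ha).trans hya.le
  rw [isClosed_cantorSet.mem_iff_infDist_zero ⟨0, zero_mem_cantorSet⟩]
  exact le_antisymm (by simpa [hx1] using hle) Metric.infDist_nonneg

lemma hausdorffMeasure_cantorSet_prod_zero :
    μH[((2 : ℕ) : ℝ) - 1] {x : EuclideanSpace ℝ (Fin 2) | x 0 ∈ cantorSet ∧ x 1 = 0} = 0 := by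
  have hiso : Isometry fun s : ℝ => (!₂[s, 0] : EuclideanSpace ℝ (Fin 2)) :=
    Isometry.of_dist_eq fun s t => by simp [EuclideanSpace.dist_eq]
  have himage : {x : EuclideanSpace ℝ (Fin 2) | x 0 ∈ cantorSet ∧ x 1 = 0} =
      (fun s : ℝ => !₂[s, 0]) '' cantorSet := by
    ext x
    refine ⟨fun ⟨hx0, hx1⟩ => ⟨x 0, hx0, by ext i; fin_cases i <;> simp [hx1]⟩, ?_⟩
    rintro ⟨s, hs, rfl⟩
    exact ⟨hs, rfl⟩
  have hdim : ((2 : ℕ) : ℝ) - 1 = 1 := by norm_num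
  rw [himage, hdim, hiso.hausdorffMeasure_image (.inl zero_le_one), hausdorffMeasure_real,
    volume_cantorSet]

section Witness

variable {u : H1 biconeDomain}

lemma mem_H1tr_of_ae_eq_heightSign
    (hu : h1Rep u =ᵐ[volume.restrict biconeDomain] heightSign) :
    u ∈ H1tr biconeDomain :=
  mem_H1tr_of_eventually_eq isOpen_biconeDomain isBounded_biconeDomain measurable_heightSign
    abs_heightSign_le hausdorffMeasure_cantorSet_prod_zero
    (fun _ hx => heightSign_eventually_eq fun hx1 =>
      hx.2 ⟨mem_cantorSet_of_mem_closure_biconeDomain hx.1 hx1, hx1⟩) hu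

lemma limitForm_eq_one
    (hu : h1Rep u =ᵐ[volume.restrict biconeDomain] heightSign) :
    limitForm u = 1 := by
  have hline (n : ℕ) : lineForm n u = 1 := by
    refine (lineForm_of_continuousOn n (continuousOn_of_eventually_eq fun _ =>
      heightSign_eventually_eq_of_mem) hu).2.trans ?_
    simp [heightSign_of_pos, lineHeight_pos, setAverage_const, volume_lineDomain_ne_zero,
      volume_lineDomain_ne_top]
  exact tendsto_nhds_unique (tendsto_lineForm_apply u)
    (tendsto_const_nhds.congr fun n => (hline n).symm)

lemma limitForm_reflectH1_eq_neg_one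
    (hu : h1Rep u =ᵐ[volume.restrict biconeDomain] heightSign) :
    limitForm (reflectH1 u) = -1 := by
  have hline (n : ℕ) : lineForm n (reflectH1 u) = -1 := by
    refine (lineForm_reflectH1_of_continuousOn n (continuousOn_of_eventually_eq fun _ =>
      heightSign_eventually_eq_of_mem) hu).2.trans ?_
    simp [heightSign_of_neg, lineHeight_pos, setAverage_const, volume_lineDomain_ne_zero,
      volume_lineDomain_ne_top]
  exact tendsto_nhds_unique (tendsto_lineForm_apply (reflectH1 u))
    (tendsto_const_nhds.congr fun n => (hline n).symm)

lemma limitForm_sub_reflectH1_eq_two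
    (hu : h1Rep u =ᵐ[volume.restrict biconeDomain] heightSign) :
    (limitForm - limitForm.comp reflectH1) u = 2 :=
  (congrArg₂ (· - ·) (limitForm_eq_one hu) (limitForm_reflectH1_eq_neg_one hu)).trans
    (by norm_num)

lemma notMem_H1tilde_of_ae_eq_heightSign
    (hu : h1Rep u =ᵐ[volume.restrict biconeDomain] heightSign) :
    u ∉ H1tilde biconeDomain := fun hmem =>
  two_ne_zero ((limitForm_sub_reflectH1_eq_two hu).symm.trans
    (limitForm_sub_reflectH1_of_mem_H1tilde hmem))

end Witness

end

theorem mainTheorem7 :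
    IsOpen biconeDomain ∧ Bornology.IsBounded biconeDomain ∧
    (∃ u : H1 biconeDomain,
      -- the witness: `1` on the upper half and `-1` on the lower half
      (∀ᵐ x ∂volume.restrict biconeDomain,
        (0 < x 1 → h1Rep u x = 1) ∧ (x 1 < 0 → h1Rep u x = -1)) ∧
      u ∈ H1tr biconeDomain \ H1tilde biconeDomain ∧
      -- the continuous linear form that separates it from the closed subspace
      ∃ (νn : ℕ → H1 biconeDomain →L[ℝ] ℝ) (ν νψ : H1 biconeDomain →L[ℝ] ℝ),
        (∀ n, IsHorizontalAverage biconeDomain (lineHeight n) (lineDomain n) (νn n)) ∧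
        Tendsto νn atTop (𝓝 ν) ∧
        (∀ v : H1 biconeDomain, ∃ w : H1 biconeDomain,
          h1Rep w =ᵐ[volume.restrict biconeDomain] (fun x => h1Rep v (reflect x)) ∧ νψ v = ν w) ∧
        (∀ v ∈ H1tilde biconeDomain, (ν - νψ) v = 0) ∧
        (ν - νψ) u = 2) := by
  refine ⟨isOpen_biconeDomain, isBounded_biconeDomain,
    exists_h1Rep_ae_eq_heightSign.imp fun u hu => ⟨hu.mono fun x hx => ?_,
      ⟨mem_H1tr_of_ae_eq_heightSign hu, notMem_H1tilde_of_ae_eq_heightSign hu⟩,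
      lineForm, limitForm, limitForm.comp reflectH1,
      isHorizontalAverage_lineForm, tendsto_lineForm, fun v => ⟨reflectH1 v, ?_, rfl⟩,
      fun v hv => ?_, limitForm_sub_reflectH1_eq_two hu⟩⟩
  · exact ⟨fun h => hx.trans (heightSign_of_pos h), fun h => hx.trans (heightSign_of_neg h)⟩
  · exact h1Rep_reflectH1 v
  · exact limitForm_sub_reflectH1_of_mem_H1tilde hv
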